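/- Work in second-order arithmetic. Inside $\mathsf{RCA}_0$, a quasi-order is a set $Q\subseteq\mathbb N$ with a set $\le_Q\,\subseteq Q\times Q$ that is a reflexive and transitive relation; a well-order is a quasi-order that is antisymmetric and total and has no infinite strictly descending sequence. $\mathcal P_{\mathrm f}(A)$ denotes the set of (codes of) finite subsets of $A$. For $A,B\subseteq Q$ write $A\le_Q^\flat B$ if $(\forall a\in A)(\exists b\in B)(a\le_Q b)$, and for $E\subseteq Q$ let $X\in\{E\}{\downarrow}^\flat$ abbreviate $X\subseteq Q\wedge X\le_Q^\flat E$. The space $\mathrm{upper}(\mathcal P^\flat(Q))$ has as points the sets $X\subseteq Q$ and as indices of basic open sets the elements $\mathbf i\in\mathcal P_{\mathrm f}(Q)$, where $X$ is in the basic open set with index $\mathbf i$ if and only if $(\forall q\in\mathbf i)(\exists x\in X)(q\le_Q x)$. A function $h\colon\mathbb N\to\mathcal P_{\mathrm f}(\mathcal P_{\mathrm f}(Q))$ codes the effectively closed set $F_h$ of all points $X$ that are in no basic open set with index $\mathbf i\in h(n)$, $n\in\mathbb N$. To say that $\{E\}{\downarrow}^\flat$ is effectively closed in $\mathrm{upper}(\mathcal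 P^\flat(Q))$ means that there is such an $h$ with $X\in\{E\}{\downarrow}^\flat\leftrightarrow X\in F_h$ for all $X\subseteq Q$. **Proposition 3.10.** The following are equivalent over $\mathsf{RCA}_0$ (equivalently, in every model of $\mathsf{RCA}_0$, not necessarily an $\omega$-model, they have the same truth value): (i) $\mathsf{ACA}_0$. (ii) If $Q$ is a quasi-order and $E\subseteq Q$, then $\{E\}{\downarrow}^\flat$ is effectively closed in $\mathrm{upper}(\mathcal P^\flat(Q))$. (iii) If $W$ is a well-order and $E\subseteq W$, then $\{E\}{\downarrow}^\flat$ is effectively closed in $\mathrm{upper}(\mathcal P^\flat(W))$. -/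

import Mathlib

universe u

namespace SecondOrderArith

/-! ### The language of second-order arithmetic -/

/-- Numerical terms, over number variables indexed by `ℕ`. -/
inductive NumTerm : Type
  | var (i : ℕ)
  | zero
  | one
  | add (s t : NumTerm)
  | mul (s t : NumTerm)

/-- The number variable `i` occurs in the term. -/
def NumTerm.Occurs (i : ℕ) : NumTerm → Prop
  | var j => i = j
  | zero => False
  | one => False
  | add s t => s.Occurs i ∨ t.Occurs i
  | mul s t => s.Occurs i ∨ t.Occurs i

/-- Formulas of second-order arithmetic: number variables and set variables are both indexed
by `ℕ`; `all`, `ex` bind number variables, `allSet`, `exSet` bind set variables. -/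
inductive Formula : Type
  | eq (s t : NumTerm)
  | lt (s t : NumTerm)
  | mem (t : NumTerm) (X : ℕ)
  | neg (φ : Formula)
  | and (φ ψ : Formula)
  | or (φ ψ : Formula)
  | imp (φ ψ : Formula)
  | all (i : ℕ) (φ : Formula)
  | ex (i : ℕ) (φ : Formula)
  | allSet (X : ℕ) (φ : Formula)
  | exSet (X : ℕ) (φ : Formula)

namespace Formula

/-- Bounded-quantifier formulas: all quantifiers have the form `∀ i < t` or `∃ i < t`, where
the number variable `i` does not occur in the term `t`; set parameters are allowed. -/
inductive IsBounded : Formula → Prop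
  | eq (s t : NumTerm) : IsBounded (eq s t)
  | lt (s t : NumTerm) : IsBounded (lt s t)
  | mem (t : NumTerm) (X : ℕ) : IsBounded (mem t X)
  | neg {φ : Formula} : IsBounded φ → IsBounded (neg φ)
  | and {φ ψ : Formula} : IsBounded φ → IsBounded ψ → IsBounded (and φ ψ)
  | or {φ ψ : Formula} : IsBounded φ → IsBounded ψ → IsBounded (or φ ψ)
  | imp {φ ψ : Formula} : IsBounded φ → IsBounded ψ → IsBounded (imp φ ψ)
  | ball {i : ℕ} {t : NumTerm} {φ : Formula} : ¬ t.Occurs i → IsBounded φ →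
      IsBounded (all i (imp (lt (NumTerm.var i) t) φ))
  | bex {i : ℕ} {t : NumTerm} {φ : Formula} : ¬ t.Occurs i → IsBounded φ →
      IsBounded (ex i (and (lt (NumTerm.var i) t) φ))

/-- `Σ⁰₁` formulas: one number quantifier `∃` in front of a bounded-quantifier formula. -/
def IsSigma01 (φ : Formula) : Prop := ∃ (i : ℕ) (θ : Formula), θ.IsBounded ∧ φ = ex i θ

/-- `Π⁰₁` formulas: one number quantifier `∀` in front of a bounded-quantifier formula. -/
def IsPi01 (φ : Formula) : Prop := ∃ (i : ℕ) (θ : Formula), θ.IsBounded ∧ φ = all i θ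

/-- Arithmetical formulas: those without set quantifiers (set parameters are allowed). -/
def IsArithmetical : Formula → Prop
  | eq _ _ => True
  | lt _ _ => True
  | mem _ _ => True
  | neg φ => φ.IsArithmetical
  | and φ ψ => φ.IsArithmetical ∧ ψ.IsArithmetical
  | or φ ψ => φ.IsArithmetical ∧ ψ.IsArithmetical
  | imp φ ψ => φ.IsArithmetical ∧ ψ.IsArithmetical
  | all _ φ => φ.IsArithmetical
  | ex _ φ => φ.IsArithmetical
  | allSet _ _ => False
  | exSet _ _ => False

end Formula

/-! ### Structures and satisfaction -/

/-- A (Henkin) structure for the language of second-order arithmetic: the number variables range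
over the nonempty domain `Num`, which may be nonstandard, and the set variables range over a
nonempty collection `sets` of subsets of `Num`, which need not contain all of them. -/
structure Model where
  Num : Type u
  zero : Num
  one : Num
  add : Num → Num → Num
  mul : Num → Num → Num
  lt : Num → Num → Prop
  sets : Set (Set Num)
  sets_nonempty : sets.Nonempty

/-- The value of a term under an assignment of the number variables. -/
def NumTerm.eval (M : Model.{u}) (ρ : ℕ → M.Num) : NumTerm → M.Num
  | var i => ρ i
  | zero => M.zero
  | one => M.one
  | add s t => M.add (s.eval M ρ) (t.eval M ρ)
  | mul s t => M.mul (s.eval M ρ) (t.eval M ρ)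

/-- Truth of a formula in `M` under assignments `ρ` of the number variables and `σ` of the set
variables; set quantifiers range over `M.sets`. -/
def Formula.Holds (M : Model.{u}) : Formula → (ℕ → M.Num) → (ℕ → M.sets) → Prop
  | eq s t, ρ, _ => s.eval M ρ = t.eval M ρ
  | lt s t, ρ, _ => M.lt (s.eval M ρ) (t.eval M ρ)
  | mem t X, ρ, σ => t.eval M ρ ∈ (σ X).1
  | neg φ, ρ, σ => ¬ φ.Holds M ρ σ
  | and φ ψ, ρ, σ => φ.Holds M ρ σ ∧ ψ.Holds M ρ σ
  | or φ ψ, ρ, σ => φ.Holds M ρ σ ∨ ψ.Holds M ρ σ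
  | imp φ ψ, ρ, σ => φ.Holds M ρ σ → ψ.Holds M ρ σ
  | all i φ, ρ, σ => ∀ a : M.Num, φ.Holds M (Function.update ρ i a) σ
  | ex i φ, ρ, σ => ∃ a : M.Num, φ.Holds M (Function.update ρ i a) σ
  | allSet X φ, ρ, σ => ∀ A : M.sets, φ.Holds M ρ (Function.update σ X A)
  | exSet X φ, ρ, σ => ∃ A : M.sets, φ.Holds M ρ (Function.update σ X A)

namespace Model

/-! ### The axiom systems -/

/-- The numbers of `M` form a discretely ordered commutative semiring with identity, with least
element `0`. -/
structure BasicAxioms (M : Model.{u}) : Prop where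
  add_assoc : ∀ a b c, M.add (M.add a b) c = M.add a (M.add b c)
  add_comm : ∀ a b, M.add a b = M.add b a
  add_zero : ∀ a, M.add a M.zero = a
  mul_assoc : ∀ a b c, M.mul (M.mul a b) c = M.mul a (M.mul b c)
  mul_comm : ∀ a b, M.mul a b = M.mul b a
  mul_one : ∀ a, M.mul a M.one = a
  mul_zero : ∀ a, M.mul a M.zero = M.zero
  mul_add : ∀ a b c, M.mul a (M.add b c) = M.add (M.mul a b) (M.mul a c)
  lt_irrefl : ∀ a, ¬ M.lt a a
  lt_trans : ∀ a b c, M.lt a b → M.lt b c → M.lt a c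
  lt_trichotomy : ∀ a b, M.lt a b ∨ a = b ∨ M.lt b a
  add_lt_add : ∀ a b c, M.lt a b → M.lt (M.add a c) (M.add b c)
  mul_lt_mul : ∀ a b c, M.lt M.zero c → M.lt a b → M.lt (M.mul a c) (M.mul b c)
  zero_lt_one : M.lt M.zero M.one
  not_lt_zero : ∀ a, ¬ M.lt a M.zero
  discrete : ∀ a, ¬ (M.lt M.zero a ∧ M.lt a M.one)

/-- Universal closure of `[φ(0) ∧ ∀ n (φ(n) → φ(n+1))] → ∀ n φ(n)`, where `n` is the number
variable `i`. -/
def InductionFor (M : Model.{u}) (φ : Formula) (i : ℕ) : Prop :=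
  ∀ (ρ : ℕ → M.Num) (σ : ℕ → M.sets),
    φ.Holds M (Function.update ρ i M.zero) σ →
    (∀ n, φ.Holds M (Function.update ρ i n) σ →
      φ.Holds M (Function.update ρ i (M.add n M.one)) σ) →
    ∀ n, φ.Holds M (Function.update ρ i n) σ

/-- The `Σ⁰₁` induction scheme. -/
def Sigma01Induction (M : Model.{u}) : Prop :=
  ∀ (φ : Formula) (i : ℕ), φ.IsSigma01 → M.InductionFor φ i

/-- The `Δ⁰₁` comprehension scheme (with parameters). -/
def Delta01Comprehension (M : Model.{u}) : Prop :=
  ∀ (φ ψ : Formula) (i : ℕ), φ.IsSigma01 → ψ.IsPi01 →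
    ∀ (ρ : ℕ → M.Num) (σ : ℕ → M.sets),
      (∀ n, φ.Holds M (Function.update ρ i n) σ ↔ ψ.Holds M (Function.update ρ i n) σ) →
      ∃ X ∈ M.sets, ∀ n, n ∈ X ↔ φ.Holds M (Function.update ρ i n) σ

/-- The induction axiom. -/
def InductionAxiom (M : Model.{u}) : Prop :=
  ∀ X ∈ M.sets, M.zero ∈ X → (∀ n, n ∈ X → M.add n M.one ∈ X) → ∀ n, n ∈ X

/-- The arithmetical comprehension scheme (with parameters). -/
def ArithmeticalComprehension (M : Model.{u}) : Prop :=
  ∀ (φ : Formula) (i : ℕ), φ.IsArithmetical →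
    ∀ (ρ : ℕ → M.Num) (σ : ℕ → M.sets),
      ∃ X ∈ M.sets, ∀ n, n ∈ X ↔ φ.Holds M (Function.update ρ i n) σ

/-- `M` is a model of `RCA₀`. -/
structure IsRCA0 (M : Model.{u}) : Prop where
  basic : M.BasicAxioms
  induction : M.Sigma01Induction
  comprehension : M.Delta01Comprehension

/-- `M` is a model of `ACA₀`. -/
structure IsACA0 (M : Model.{u}) : Prop where
  basic : M.BasicAxioms
  induction : M.InductionAxiom
  comprehension : M.ArithmeticalComprehension

/-! ### Coding of pairs, finite sets and functions, inside a model

All definitions below are formulas of second-order arithmetic interpreted in `M`: number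
quantifiers range over `M.Num`, and every set that is quantified over belongs to `M.sets`. -/

/-- The code `(a, b) = (a + b)² + a` of an ordered pair of numbers. -/
def pair (M : Model.{u}) (a b : M.Num) : M.Num :=
  M.add (M.mul (M.add a b) (M.add a b)) a

/-- `FinMem a c`: `c = ((k, m), n)` for some `k, m, n` such that `a < k` and `m(a+1)+1` divides
`n`. This is the membership relation `a ∈ c` for finite sets of numbers coded by numbers. -/
def FinMem (M : Model.{u}) (a c : M.Num) : Prop :=
  ∃ k m n, c = M.pair (M.pair k m) n ∧ M.lt a k ∧
    ∃ q, M.mul q (M.add (M.mul m (M.add a M.one)) M.one) = n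

/-- `c` is the code of a finite set: it is the least triple with its elements. -/
def IsFinCode (M : Model.{u}) (c : M.Num) : Prop :=
  (∃ k m n, c = M.pair (M.pair k m) n) ∧
    ∀ k m n, M.lt (M.pair (M.pair k m) n) c →
      ¬ ∀ a, M.FinMem a (M.pair (M.pair k m) n) ↔ M.FinMem a c

/-- `Pf A`: the (codes of) finite subsets of `A`. -/
def Pf (M : Model.{u}) (A : Set M.Num) : Set M.Num :=
  {c | M.IsFinCode c ∧ ∀ a, M.FinMem a c → a ∈ A}

/-- `F` (a set of pairs) is a function from `A` to `B`. -/
def IsFunction (M : Model.{u}) (F A B : Set M.Num) : Prop :=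
  (∀ z ∈ F, ∃ a ∈ A, ∃ b ∈ B, z = M.pair a b) ∧ ∀ a ∈ A, ∃! b, M.pair a b ∈ F

/-! ### Quasi-orders and well-orders in a model -/

/-- `(Q, R)` is a quasi-order in `M`: `Q` and `R` are sets of `M`, and `R ⊆ Q × Q` is a reflexive
and transitive relation on `Q`. The relation `p ≤ q` is `M.pair p q ∈ R`. -/
structure IsQuasiOrder (M : Model.{u}) (Q R : Set M.Num) : Prop where
  carrier_mem : Q ∈ M.sets
  rel_mem : R ∈ M.sets
  rel_subset : ∀ z ∈ R, ∃ p ∈ Q, ∃ q ∈ Q, z = M.pair p q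
  refl : ∀ q ∈ Q, M.pair q q ∈ R
  trans : ∀ p ∈ Q, ∀ q ∈ Q, ∀ r ∈ Q, M.pair p q ∈ R → M.pair q r ∈ R → M.pair p r ∈ R

/-- `(W, R)` is a well-order in `M`: a linear order without an infinite strictly descending
sequence in `M`. -/
structure IsWellOrder (M : Model.{u}) (W R : Set M.Num) : Prop extends M.IsQuasiOrder W R where
  antisymm : ∀ p ∈ W, ∀ q ∈ W, M.pair p q ∈ R → M.pair q p ∈ R → p = q
  total : ∀ p ∈ W, ∀ q ∈ W, M.pair p q ∈ R ∨ M.pair q p ∈ R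
  no_descending : ¬ ∃ f ∈ M.sets, M.IsFunction f Set.univ W ∧
    ∀ n a b, M.pair n a ∈ f → M.pair (M.add n M.one) b ∈ f →
      M.pair b a ∈ R ∧ M.pair a b ∉ R

/-! ### The upper topology on `P♭(Q)` -/

/-- `A ≤♭ B`: every element of `A` is below some element of `B`. -/
def FlatLE (M : Model.{u}) (R A B : Set M.Num) : Prop :=
  ∀ a ∈ A, ∃ b ∈ B, M.pair a b ∈ R

/-- The point `X ⊆ Q` lies in the basic open set of `upper(P♭(Q))` with index `i ∈ Pf Q`, that
is, `i ⊆ X↓`. -/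
def FlatInBasic (M : Model.{u}) (R X : Set M.Num) (i : M.Num) : Prop :=
  ∀ q, M.FinMem q i → ∃ x ∈ X, M.pair q x ∈ R

/-- The point `X ⊆ Q` lies in the effectively closed set `F_h` of `upper(P♭(Q))` coded by the
function `h : ℕ → Pf (Pf Q)`, that is, in no basic open set with index in some `h(n)`. -/
def FlatInClosed (M : Model.{u}) (R h X : Set M.Num) : Prop :=
  ∀ n c, M.pair n c ∈ h → ∀ i, M.FinMem i c → ¬ M.FlatInBasic R X i

/-- The downward closure `{E}↓♭` with respect to `≤♭` is effectively closed in `upper(P♭(Q))`: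
some code `h : ℕ → Pf (Pf Q)` in `M` satisfies `X ∈ {E}↓♭ ↔ X ∈ F_h` for all points `X`. -/
def PrincipalFlatClosed (M : Model.{u}) (Q R E : Set M.Num) : Prop :=
  ∃ h ∈ M.sets, M.IsFunction h Set.univ (M.Pf (M.Pf Q)) ∧
    ∀ X ∈ M.sets, X ⊆ Q → (M.FlatLE R X E ↔ M.FlatInClosed R h X)

/-- For every quasi-order `Q` and `E ⊆ Q`, `{E}↓♭` is effectively closed in `upper(P♭(Q))`. -/
def FlatClosedForQuasiOrders (M : Model.{u}) : Prop :=
  ∀ Q R E : Set M.Num, M.IsQuasiOrder Q R → E ∈ M.sets → E ⊆ Q → M.PrincipalFlatClosed Q R E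

/-- For every well-order `W` and `E ⊆ W`, `{E}↓♭` is effectively closed in `upper(P♭(W))`. -/
def FlatClosedForWellOrders (M : Model.{u}) : Prop :=
  ∀ W R E : Set M.Num, M.IsWellOrder W R → E ∈ M.sets → E ⊆ W → M.PrincipalFlatClosed W R E

end Model

end SecondOrderArith

/-!
For (i) → (ii), a set `X` fails to lie in `{E}↓♭` if and only if it lies in the basic open set of
some finite `i ⊆ Q` with an element that is below no element of `E`; by arithmetical comprehension
these `i` form a set.

For (iii) → (i), it suffices that the range of an injective function `f` is a set. Order the stages
of the enumeration `f` so that a stage lies below a later one if and only if the later one has seen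
it to be false, that is, has seen a smaller value enumerated after it. Then the false stages form
an initial segment of type at most `ω` and the true stages above them are ordered by type `ω*`. If
the range of `f` is not a set, this is a well-order in the sense of `M`, because an infinite
descending sequence would consist of true stages, from which the range can be computed. Let `E` be
the set of the stages `e` with `f (e + 1) < f e`, all of them false. The true stages are those that
lie below no element of `E`, and an effectively closed code of `{E}↓♭` makes this a `Σ⁰₁` property,
so the range of `f` is a set after all.
-/

namespace SecondOrderArith

theorem Formula.IsBounded.isArithmetical {φ : Formula} (h : φ.IsBounded) : φ.IsArithmetical := by
  induction h with
  | eq | lt | mem => trivial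
  | neg _ ih => exact ih
  | and _ _ ih₁ ih₂ | or _ _ ih₁ ih₂ | imp _ _ ih₁ ih₂ => exact ⟨ih₁, ih₂⟩
  | ball _ _ ih | bex _ _ ih => exact ⟨trivial, ih⟩

namespace Model

section OrderedSemiring

variable {M : Model.{u}}

instance [hM : Fact M.IsRCA0] : Fact M.BasicAxioms := ⟨hM.out.basic⟩

variable [hM : Fact M.BasicAxioms]

noncomputable instance : CommSemiring M.Num where
  add := M.add
  zero := M.zero
  mul := M.mul
  one := M.one
  add_assoc := hM.out.add_assoc
  add_comm := hM.out.add_comm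
  add_zero := hM.out.add_zero
  zero_add a := (hM.out.add_comm _ a).trans (hM.out.add_zero a)
  mul_assoc := hM.out.mul_assoc
  mul_comm := hM.out.mul_comm
  mul_one := hM.out.mul_one
  one_mul a := (hM.out.mul_comm _ a).trans (hM.out.mul_one a)
  mul_zero := hM.out.mul_zero
  zero_mul a := (hM.out.mul_comm _ a).trans (hM.out.mul_zero a)
  left_distrib := hM.out.mul_add
  right_distrib a b c := by
    change M.mul (M.add a b) c = M.add (M.mul a c) (M.mul b c)
    rw [hM.out.mul_comm, hM.out.mul_add, hM.out.mul_comm c a, hM.out.mul_comm c b]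
  nsmul := @nsmulRec _ ⟨M.zero⟩ ⟨M.add⟩

open Classical in
noncomputable instance : LinearOrder M.Num :=
  haveI : IsStrictTotalOrder M.Num M.lt :=
    { trichotomous a b hab hba := ((hM.out.lt_trichotomy a b).resolve_left hab).resolve_right hba
      irrefl := hM.out.lt_irrefl
      trans := hM.out.lt_trans }
  linearOrderOfSTO M.lt

instance : IsStrictOrderedRing M.Num :=
  haveI : Nontrivial M.Num := ⟨0, 1, (show (0 : M.Num) < 1 from hM.out.zero_lt_one).ne⟩
  haveI : IsOrderedAddMonoid M.Num :=
    { add_le_add_left := fun a b h c => h.eq_or_lt.elim (fun h => (congrArg (· + c) h).le)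
        fun h => le_of_lt (hM.out.add_lt_add a b c h) }
  { le_of_add_le_add_left := fun a b c h => by
      by_contra! hcb
      have : c + a < b + a := hM.out.add_lt_add c b a hcb
      rw [add_comm c, add_comm b] at this
      exact h.not_gt this
    zero_le_one := (show (0 : M.Num) < 1 from hM.out.zero_lt_one).le
    mul_lt_mul_of_pos_left := fun a ha b c h => by
      rw [mul_comm a, mul_comm a]
      exact hM.out.mul_lt_mul b c a ha h
    mul_lt_mul_of_pos_right := fun a ha b c h => hM.out.mul_lt_mul b c a ha h }

end OrderedSemiring

section Definability

variable (M : Model.{u}) [Fact M.BasicAxioms]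

/-- `f` is given by a term of the language with parameters from `M`. The free variables are the
entries of a tuple, so that no names of variables have to be managed. -/
inductive TermDefinable {n : ℕ} : ((Fin n → M.Num) → M.Num) → Prop
  | var (i : Fin n) : TermDefinable fun v => v i
  | const (a : M.Num) : TermDefinable fun _ => a
  | add {f g : (Fin n → M.Num) → M.Num} : TermDefinable f → TermDefinable g →
      TermDefinable fun v => f v + g v
  | mul {f g : (Fin n → M.Num) → M.Num} : TermDefinable f → TermDefinable g →
      TermDefinable fun v => f v * g v

/-- `P` is given by a bounded-quantifier formula with number and set parameters from `M`. In the
body of a quantifier the entry `0` of the tuple is the quantified variable. -/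
inductive BoundedDefinable : {n : ℕ} → ((Fin n → M.Num) → Prop) → Prop
  | eq {n : ℕ} {f g : (Fin n → M.Num) → M.Num} : M.TermDefinable f → M.TermDefinable g →
      BoundedDefinable fun v => f v = g v
  | lt {n : ℕ} {f g : (Fin n → M.Num) → M.Num} : M.TermDefinable f → M.TermDefinable g →
      BoundedDefinable fun v => f v < g v
  | mem {n : ℕ} {f : (Fin n → M.Num) → M.Num} {X : Set M.Num} : M.TermDefinable f → X ∈ M.sets →
      BoundedDefinable fun v => f v ∈ X
  | neg {n : ℕ} {P : (Fin n → M.Num) → Prop} : BoundedDefinable P → BoundedDefinable fun v => ¬ P v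
  | and {n : ℕ} {P Q : (Fin n → M.Num) → Prop} : BoundedDefinable P → BoundedDefinable Q →
      BoundedDefinable fun v => P v ∧ Q v
  | or {n : ℕ} {P Q : (Fin n → M.Num) → Prop} : BoundedDefinable P → BoundedDefinable Q →
      BoundedDefinable fun v => P v ∨ Q v
  | imp {n : ℕ} {P Q : (Fin n → M.Num) → Prop} : BoundedDefinable P → BoundedDefinable Q →
      BoundedDefinable fun v => P v → Q v
  | ball {n : ℕ} {f : (Fin n → M.Num) → M.Num} {P : (Fin n → M.Num) → M.Num → Prop} :
      M.TermDefinable f →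
      BoundedDefinable (fun w : Fin (n + 1) → M.Num => P (fun i => w i.succ) (w 0)) →
      BoundedDefinable fun v => ∀ x, x < f v → P v x
  | bex {n : ℕ} {f : (Fin n → M.Num) → M.Num} {P : (Fin n → M.Num) → M.Num → Prop} :
      M.TermDefinable f →
      BoundedDefinable (fun w : Fin (n + 1) → M.Num => P (fun i => w i.succ) (w 0)) →
      BoundedDefinable fun v => ∃ x, x < f v ∧ P v x

/-- `P` is given by a `Σ⁰₁` formula with number and set parameters from `M`. -/
def Sigma01Definable {n : ℕ} (P : (Fin n → M.Num) → Prop) : Prop :=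
  ∃ Q : (Fin n → M.Num) → M.Num → Prop,
    M.BoundedDefinable (fun w : Fin (n + 1) → M.Num => Q (fun i => w i.succ) (w 0)) ∧
      ∀ v, P v ↔ ∃ x, Q v x

/-- `P` is defined by bounded-quantifier formulas, in the following uniform sense: only finitely
many parameters occur, and they and the entries of the tuple can be placed in any variables. -/
def Realizable {n : ℕ} (P : (Fin n → M.Num) → Prop) : Prop :=
  ∃ (F : Finset M.Num) (G : Finset M.sets),
    ∀ (e : Fin n → ℕ) (p : M.Num → ℕ) (g : M.sets → ℕ), ∃ θ : Formula, θ.IsBounded ∧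
      ∀ (ρ : ℕ → M.Num) (σ : ℕ → M.sets), (∀ a ∈ F, ρ (p a) = a) → (∀ A ∈ G, σ (g A) = A) →
        (θ.Holds M ρ σ ↔ P fun i => ρ (e i))

variable {M} {n : ℕ}

theorem TermDefinable.exists_term {f : (Fin n → M.Num) → M.Num} (hf : M.TermDefinable f) :
    ∃ F : Finset M.Num, ∀ (e : Fin n → ℕ) (p : M.Num → ℕ), ∃ t : NumTerm,
      (∀ x, t.Occurs x → x ∈ Set.range e ∪ p '' F) ∧
        ∀ ρ : ℕ → M.Num, (∀ a ∈ F, ρ (p a) = a) → t.eval M ρ = f fun i => ρ (e i) := by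
  classical
  have binary {s t : NumTerm} {A : Set ℕ} {p : M.Num → ℕ} {F G : Finset M.Num}
      (hs : ∀ x, s.Occurs x → x ∈ A ∪ p '' F) (ht : ∀ x, t.Occurs x → x ∈ A ∪ p '' G) (x : ℕ)
      (h : s.Occurs x ∨ t.Occurs x) : x ∈ A ∪ p '' ↑(F ∪ G) := by
    rw [Finset.coe_union, Set.image_union]
    exact h.elim (fun h => (hs x h).imp_right Or.inl) fun h => (ht x h).imp_right Or.inr
  induction hf with
  | var i => exact ⟨∅, fun e p => ⟨.var (e i), fun x hx => .inl ⟨i, hx.symm⟩, fun ρ _ => rfl⟩⟩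
  | const a =>
    exact ⟨{a}, fun e p => ⟨.var (p a), fun x hx => .inr ⟨a, by simp, hx.symm⟩,
      fun ρ hρ => hρ a (Finset.mem_singleton_self a)⟩⟩
  | add _ _ ihf ihg =>
    obtain ⟨F, hF⟩ := ihf
    obtain ⟨G, hG⟩ := ihg
    refine ⟨F ∪ G, fun e p => ?_⟩
    obtain ⟨s, hs, hs'⟩ := hF e p
    obtain ⟨t, ht, ht'⟩ := hG e p
    exact ⟨.add s t, binary hs ht, fun ρ hρ => congrArg₂ M.add
      (hs' ρ fun a ha => hρ a (Finset.mem_union_left _ ha))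
      (ht' ρ fun a ha => hρ a (Finset.mem_union_right _ ha))⟩
  | mul _ _ ihf ihg =>
    obtain ⟨F, hF⟩ := ihf
    obtain ⟨G, hG⟩ := ihg
    refine ⟨F ∪ G, fun e p => ?_⟩
    obtain ⟨s, hs, hs'⟩ := hF e p
    obtain ⟨t, ht, ht'⟩ := hG e p
    exact ⟨.mul s t, binary hs ht, fun ρ hρ => congrArg₂ M.mul
      (hs' ρ fun a ha => hρ a (Finset.mem_union_left _ ha))
      (ht' ρ fun a ha => hρ a (Finset.mem_union_right _ ha))⟩

theorem Realizable.binary {P Q : (Fin n → M.Num) → Prop} (hP : M.Realizable P)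
    (hQ : M.Realizable Q) {C : Formula → Formula → Formula} {c : Prop → Prop → Prop}
    (hC : ∀ {φ ψ : Formula}, φ.IsBounded → ψ.IsBounded → (C φ ψ).IsBounded)
    (hc : ∀ φ ψ ρ σ, (C φ ψ).Holds M ρ σ = c (φ.Holds M ρ σ) (ψ.Holds M ρ σ)) :
    M.Realizable fun v => c (P v) (Q v) := by
  classical
  obtain ⟨F, G, hP⟩ := hP
  obtain ⟨F', G', hQ⟩ := hQ
  refine ⟨F ∪ F', G ∪ G', fun e p g => ?_⟩
  obtain ⟨φ, hφ, hφ'⟩ := hP e p g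
  obtain ⟨ψ, hψ, hψ'⟩ := hQ e p g
  refine ⟨C φ ψ, hC hφ hψ, fun ρ σ hρ hσ => iff_of_eq ?_⟩
  rw [hc, propext (hφ' ρ σ (fun a ha => hρ a (Finset.mem_union_left _ ha))
    fun A hA => hσ A (Finset.mem_union_left _ hA)),
    propext (hψ' ρ σ (fun a ha => hρ a (Finset.mem_union_right _ ha))
    fun A hA => hσ A (Finset.mem_union_right _ hA))]

theorem TermDefinable.realizable_compare {f g : (Fin n → M.Num) → M.Num}
    (hf : M.TermDefinable f) (hg : M.TermDefinable g) {C : NumTerm → NumTerm → Formula}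
    {c : M.Num → M.Num → Prop} (hC : ∀ s t, (C s t).IsBounded)
    (hc : ∀ s t ρ σ, (C s t).Holds M ρ σ = c (s.eval M ρ) (t.eval M ρ)) :
    M.Realizable fun v => c (f v) (g v) := by
  classical
  obtain ⟨F, hF⟩ := hf.exists_term
  obtain ⟨G, hG⟩ := hg.exists_term
  refine ⟨F ∪ G, ∅, fun e p g => ?_⟩
  obtain ⟨s, -, hs⟩ := hF e p
  obtain ⟨t, -, ht⟩ := hG e p
  refine ⟨C s t, hC s t, fun ρ σ hρ _ => iff_of_eq ?_⟩
  rw [hc, hs ρ fun a ha => hρ a (Finset.mem_union_left _ ha),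
    ht ρ fun a ha => hρ a (Finset.mem_union_right _ ha)]

theorem Realizable.exists_quantifier_body {f : (Fin n → M.Num) → M.Num}
    {P : (Fin n → M.Num) → M.Num → Prop} (hf : M.TermDefinable f)
    (hP : M.Realizable fun w : Fin (n + 1) → M.Num => P (fun i => w i.succ) (w 0)) :
    ∃ (F : Finset M.Num) (G : Finset M.sets),
      ∀ (e : Fin n → ℕ) (p : M.Num → ℕ) (g : M.sets → ℕ), ∃ (x : ℕ) (t : NumTerm) (θ : Formula),
        ¬ t.Occurs x ∧ θ.IsBounded ∧ ∀ (ρ : ℕ → M.Num) (σ : ℕ → M.sets),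
          (∀ a ∈ F, ρ (p a) = a) → (∀ A ∈ G, σ (g A) = A) → ∀ a,
            ((Formula.lt (.var x) t).Holds M (Function.update ρ x a) σ ↔
              a < f fun i => ρ (e i)) ∧
            (θ.Holds M (Function.update ρ x a) σ ↔ P (fun i => ρ (e i)) a) := by
  classical
  obtain ⟨F, hF⟩ := hf.exists_term
  obtain ⟨F', G, hP⟩ := hP
  refine ⟨F ∪ F', G, fun e p g => ?_⟩
  obtain ⟨t, htx, ht⟩ := hF e p
  obtain ⟨x, hx⟩ :=
    ((Set.finite_range e).union (((F ∪ F').finite_toSet).image p)).exists_notMem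
  have hxe (i) : e i ≠ x := fun h => hx (.inl ⟨i, h⟩)
  have hxp {a} (ha : a ∈ F ∪ F') : p a ≠ x := fun h => hx (.inr ⟨a, ha, h⟩)
  obtain ⟨θ, hθ, hθ'⟩ := hP (Fin.cons x e) p g
  refine ⟨x, t, θ, fun h => hx ((htx x h).imp_right fun ⟨a, ha, h⟩ =>
    ⟨a, Finset.mem_union_left _ ha, h⟩), hθ, fun ρ σ hρ hσ a => ?_⟩
  have hρ' (b) (hb : b ∈ F ∪ F') : Function.update ρ x a (p b) = b := by
    rw [Function.update_of_ne (hxp hb), hρ b hb]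
  constructor
  · change Function.update ρ x a x < t.eval M (Function.update ρ x a) ↔ _
    rw [ht _ fun b hb => hρ' b (Finset.mem_union_left _ hb)]
    simp only [Function.update_self, Function.update_of_ne (hxe _)]
  · rw [hθ' _ σ (fun b hb => hρ' b (Finset.mem_union_right _ hb)) hσ]
    simp only [Fin.cons_succ, Fin.cons_zero, Function.update_self, Function.update_of_ne (hxe _)]

theorem BoundedDefinable.realizable {P : (Fin n → M.Num) → Prop} (hP : M.BoundedDefinable P) :
    M.Realizable P := by
  induction hP with
  | eq hf hg => exact hf.realizable_compare hg .eq fun _ _ _ _ => rfl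
  | lt hf hg => exact hf.realizable_compare hg .lt fun _ _ _ _ => rfl
  | @mem n f X hf hX =>
    obtain ⟨F, hF⟩ := hf.exists_term
    refine ⟨F, {⟨X, hX⟩}, fun e p g => ?_⟩
    obtain ⟨t, -, ht⟩ := hF e p
    refine ⟨.mem t (g ⟨X, hX⟩), .mem _ _, fun ρ σ hρ hσ => ?_⟩
    rw [Formula.Holds, ht ρ hρ, hσ _ (Finset.mem_singleton_self _)]
  | neg _ ih =>
    obtain ⟨F, G, h⟩ := ih
    refine ⟨F, G, fun e p g => ?_⟩
    obtain ⟨θ, hθ, hθ'⟩ := h e p g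
    exact ⟨.neg θ, .neg hθ, fun ρ σ hρ hσ => not_congr (hθ' ρ σ hρ hσ)⟩
  | and _ _ ihP ihQ => exact ihP.binary ihQ .and fun _ _ _ _ => rfl
  | or _ _ ihP ihQ => exact ihP.binary ihQ .or fun _ _ _ _ => rfl
  | imp _ _ ihP ihQ => exact ihP.binary (c := (· → ·)) ihQ .imp fun _ _ _ _ => rfl
  | ball hf _ ih =>
    obtain ⟨F, G, h⟩ := ih.exists_quantifier_body hf
    refine ⟨F, G, fun e p g => ?_⟩
    obtain ⟨x, t, θ, hx, hθ, h⟩ := h e p g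
    exact ⟨_, .ball hx hθ, fun ρ σ hρ hσ =>
      forall_congr' fun a => imp_congr (h ρ σ hρ hσ a).1 (h ρ σ hρ hσ a).2⟩
  | bex hf _ ih =>
    obtain ⟨F, G, h⟩ := ih.exists_quantifier_body hf
    refine ⟨F, G, fun e p g => ?_⟩
    obtain ⟨x, t, θ, hx, hθ, h⟩ := h e p g
    exact ⟨_, .bex hx hθ, fun ρ σ hρ hσ =>
      exists_congr fun a => and_congr (h ρ σ hρ hσ a).1 (h ρ σ hρ hσ a).2⟩

end Definability

section Substitution

variable {M : Model.{u}} [Fact M.BasicAxioms] {m n : ℕ}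

theorem TermDefinable.subst {f : (Fin n → M.Num) → M.Num} (hf : M.TermDefinable f)
    {τ : (Fin m → M.Num) → Fin n → M.Num} (hτ : ∀ i, M.TermDefinable fun v => τ v i) :
    M.TermDefinable fun v => f (τ v) := by
  induction hf with
  | var i => exact hτ i
  | const a => exact .const a
  | add _ _ ihf ihg => exact .add ihf ihg
  | mul _ _ ihf ihg => exact .mul ihf ihg

theorem TermDefinable.shift {f : (Fin n → M.Num) → M.Num} (hf : M.TermDefinable f) :
    M.TermDefinable fun w : Fin (n + 1) → M.Num => f fun i => w i.succ :=
  hf.subst fun i => .var i.succ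

theorem TermDefinable.pair {f g : (Fin n → M.Num) → M.Num} (hf : M.TermDefinable f)
    (hg : M.TermDefinable g) : M.TermDefinable fun v => M.pair (f v) (g v) :=
  .add (.mul (.add hf hg) (.add hf hg)) hf

theorem TermDefinable.cons {f : (Fin m → M.Num) → M.Num} (hf : M.TermDefinable f)
    {τ : (Fin m → M.Num) → Fin n → M.Num} (hτ : ∀ i, M.TermDefinable fun v => τ v i)
    (i : Fin (n + 1)) :
    M.TermDefinable fun v => (Fin.cons (f v) (τ v) : Fin (n + 1) → M.Num) i := by
  cases i using Fin.cases with
  | zero => exact hf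
  | succ i => exact hτ i

theorem TermDefinable.eval (t : NumTerm) {τ : (Fin n → M.Num) → ℕ → M.Num}
    (hτ : ∀ i, M.TermDefinable fun v => τ v i) : M.TermDefinable fun v => t.eval M (τ v) := by
  induction t with
  | var i => exact hτ i
  | zero => exact .const 0
  | one => exact .const 1
  | add s t hs ht => exact .add hs ht
  | mul s t hs ht => exact .mul hs ht

theorem TermDefinable.update {τ : (Fin n → M.Num) → ℕ → M.Num}
    (hτ : ∀ i, M.TermDefinable fun v => τ v i) {f : (Fin n → M.Num) → M.Num}
    (hf : M.TermDefinable f) (i j : ℕ) :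
    M.TermDefinable fun v => Function.update (τ v) i (f v) j := by
  obtain rfl | hij := eq_or_ne j i
  · simpa only [Function.update_self] using hf
  · simpa only [Function.update_of_ne hij] using hτ j

theorem BoundedDefinable.subst {P : (Fin n → M.Num) → Prop} (hP : M.BoundedDefinable P)
    {τ : (Fin m → M.Num) → Fin n → M.Num} (hτ : ∀ i, M.TermDefinable fun v => τ v i) :
    M.BoundedDefinable fun v => P (τ v) := by
  induction hP generalizing m with
  | eq hf hg => exact .eq (hf.subst hτ) (hg.subst hτ)
  | lt hf hg => exact .lt (hf.subst hτ) (hg.subst hτ)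
  | mem hf hX => exact .mem (hf.subst hτ) hX
  | neg _ ih => exact .neg (ih hτ)
  | and _ _ ihP ihQ => exact .and (ihP hτ) (ihQ hτ)
  | or _ _ ihP ihQ => exact .or (ihP hτ) (ihQ hτ)
  | imp _ _ ihP ihQ => exact .imp (ihP hτ) (ihQ hτ)
  | ball hf _ ih => exact .ball (hf.subst hτ) (ih (.cons (.var 0) fun i => (hτ i).shift))
  | bex hf _ ih => exact .bex (hf.subst hτ) (ih (.cons (.var 0) fun i => (hτ i).shift))

theorem BoundedDefinable.subst_cons {P : (Fin n → M.Num) → M.Num → Prop}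
    (hP : M.BoundedDefinable fun w : Fin (n + 1) → M.Num => P (fun i => w i.succ) (w 0))
    {f : (Fin m → M.Num) → M.Num} (hf : M.TermDefinable f)
    {τ : (Fin m → M.Num) → Fin n → M.Num} (hτ : ∀ i, M.TermDefinable fun v => τ v i) :
    M.BoundedDefinable fun v => P (τ v) (f v) :=
  hP.subst (TermDefinable.cons hf hτ)

theorem BoundedDefinable.shift {P : (Fin n → M.Num) → Prop} (hP : M.BoundedDefinable P) :
    M.BoundedDefinable fun w : Fin (n + 1) → M.Num => P fun i => w i.succ :=
  hP.subst fun i => .var i.succ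

theorem BoundedDefinable.comp₁ {P : M.Num → Prop}
    (hP : M.BoundedDefinable fun v : Fin 1 → M.Num => P (v 0)) {f : (Fin n → M.Num) → M.Num}
    (hf : M.TermDefinable f) : M.BoundedDefinable fun v => P (f v) :=
  hP.subst (τ := fun v _ => f v) fun _ => hf

theorem BoundedDefinable.comp₂ {P : M.Num → M.Num → Prop}
    (hP : M.BoundedDefinable fun v : Fin 2 → M.Num => P (v 0) (v 1))
    {f g : (Fin n → M.Num) → M.Num} (hf : M.TermDefinable f) (hg : M.TermDefinable g) :
    M.BoundedDefinable fun v => P (f v) (g v) :=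
  hP.subst (TermDefinable.cons hf (τ := fun v (_ : Fin 1) => g v) fun _ => hg)

theorem BoundedDefinable.congr {P Q : (Fin n → M.Num) → Prop} (hP : M.BoundedDefinable P)
    (h : ∀ v, P v ↔ Q v) : M.BoundedDefinable Q := by
  rwa [← funext fun v => propext (h v)]

theorem BoundedDefinable.le {f g : (Fin n → M.Num) → M.Num} (hf : M.TermDefinable f)
    (hg : M.TermDefinable g) : M.BoundedDefinable fun v => f v ≤ g v :=
  (BoundedDefinable.lt hg hf).neg.congr fun _ => not_lt

theorem BoundedDefinable.iff {P Q : (Fin n → M.Num) → Prop} (hP : M.BoundedDefinable P)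
    (hQ : M.BoundedDefinable Q) : M.BoundedDefinable fun v => P v ↔ Q v :=
  ((hP.imp hQ).and (hQ.imp hP)).congr fun _ => iff_iff_implies_and_implies.symm

theorem BoundedDefinable.const (p : Prop) : M.BoundedDefinable fun _ : Fin n → M.Num => p := by
  by_cases hp : p
  · exact (BoundedDefinable.eq (.const 0) (.const 0)).congr fun _ => iff_of_true rfl hp
  · exact (BoundedDefinable.lt (.const 0) (.const 0)).congr fun _ => iff_of_false (lt_irrefl _) hp

theorem BoundedDefinable.sigma01 {P : (Fin n → M.Num) → Prop} (hP : M.BoundedDefinable P) :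
    M.Sigma01Definable P :=
  ⟨fun v _ => P v, hP.shift, fun _ => (exists_const _).symm⟩

theorem Sigma01Definable.congr {P Q : (Fin n → M.Num) → Prop} (hP : M.Sigma01Definable P)
    (h : ∀ v, P v ↔ Q v) : M.Sigma01Definable Q := by
  rwa [← funext fun v => propext (h v)]

theorem Sigma01Definable.subst {P : (Fin n → M.Num) → Prop} (hP : M.Sigma01Definable P)
    {τ : (Fin m → M.Num) → Fin n → M.Num} (hτ : ∀ i, M.TermDefinable fun v => τ v i) :
    M.Sigma01Definable fun v => P (τ v) := by
  obtain ⟨Q, hQ, hPQ⟩ := hP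
  exact ⟨fun v x => Q (τ v) x, hQ.subst_cons (.var 0) fun i => (hτ i).shift, fun v => hPQ (τ v)⟩

theorem Sigma01Definable.comp₁ {P : M.Num → Prop}
    (hP : M.Sigma01Definable fun v : Fin 1 → M.Num => P (v 0)) {f : (Fin n → M.Num) → M.Num}
    (hf : M.TermDefinable f) : M.Sigma01Definable fun v => P (f v) :=
  hP.subst (τ := fun v _ => f v) fun _ => hf

theorem Sigma01Definable.comp₂ {P : M.Num → M.Num → Prop}
    (hP : M.Sigma01Definable fun v : Fin 2 → M.Num => P (v 0) (v 1))
    {f g : (Fin n → M.Num) → M.Num} (hf : M.TermDefinable f) (hg : M.TermDefinable g) :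
    M.Sigma01Definable fun v => P (f v) (g v) :=
  hP.subst (TermDefinable.cons hf (τ := fun v (_ : Fin 1) => g v) fun _ => hg)

theorem Sigma01Definable.of_exists {P : M.Num → M.Num → Prop}
    (hP : M.BoundedDefinable fun v : Fin 2 → M.Num => P (v 0) (v 1)) :
    M.Sigma01Definable fun v : Fin 1 → M.Num => ∃ x, P (v 0) x :=
  ⟨fun v x => P (v 0) x, hP.comp₂ (.var 1) (.var 0), fun _ => Iff.rfl⟩

theorem Sigma01Definable.exists_matrix {P : M.Num → Prop}
    (hP : M.Sigma01Definable fun v : Fin 1 → M.Num => P (v 0)) :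
    ∃ Q : M.Num → M.Num → Prop,
      (M.BoundedDefinable fun v : Fin 2 → M.Num => Q (v 0) (v 1)) ∧ ∀ a, P a ↔ ∃ x, Q a x := by
  obtain ⟨Q, hQ, hPQ⟩ := hP
  exact ⟨fun a x => Q (fun _ => a) x, hQ.subst_cons (.var 1) fun _ => .var 0,
    fun a => hPQ fun _ => a⟩

theorem Sigma01Definable.or {P Q : (Fin n → M.Num) → Prop} (hP : M.Sigma01Definable P)
    (hQ : M.Sigma01Definable Q) : M.Sigma01Definable fun v => P v ∨ Q v := by
  obtain ⟨P', hP', hP⟩ := hP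
  obtain ⟨Q', hQ', hQ⟩ := hQ
  exact ⟨fun v x => P' v x ∨ Q' v x, hP'.or hQ', fun v => by simp only [hP, hQ, exists_or]⟩

end Substitution

section Comprehension

variable {M : Model.{u}}

theorem exists_assignment {α : Type*} [Nonempty α] (F : Finset α) (k : ℕ) :
    ∃ (p : α → ℕ) (ρ : ℕ → α), ∀ a ∈ F, k ≤ p a ∧ ρ (p a) = a := by
  obtain ⟨p, hp⟩ := Set.countable_iff_exists_injOn.1 F.countable_toSet
  have hp' : Set.InjOn (fun a => p a + k) F := fun a ha b hb h => hp ha hb (Nat.add_right_cancel h)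
  exact ⟨_, _, fun a ha => ⟨Nat.le_add_left _ _, hp'.leftInvOn_invFunOn ha⟩⟩

theorem exists_bounded_formulas [Fact M.BasicAxioms] {P Q : M.Num → M.Num → Prop}
    (hP : M.BoundedDefinable fun v : Fin 2 → M.Num => P (v 0) (v 1))
    (hQ : M.BoundedDefinable fun v : Fin 2 → M.Num => Q (v 0) (v 1)) :
    ∃ (θ η : Formula) (ρ : ℕ → M.Num) (σ : ℕ → M.sets), θ.IsBounded ∧ η.IsBounded ∧
      ∀ a x, (θ.Holds M (Function.update (Function.update ρ 0 a) 1 x) σ ↔ P a x) ∧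
        (η.Holds M (Function.update (Function.update ρ 0 a) 1 x) σ ↔ Q a x) := by
  classical
  have := M.sets_nonempty.to_subtype
  have : Nonempty M.Num := ⟨0⟩
  obtain ⟨F, G, hP⟩ := hP.realizable
  obtain ⟨F', G', hQ⟩ := hQ.realizable
  obtain ⟨p, ρ, hρ⟩ := exists_assignment (F ∪ F') 2
  obtain ⟨g, σ, hσ⟩ := exists_assignment (G ∪ G') 0
  obtain ⟨θ, hθ, hθP⟩ := hP ![0, 1] p g
  obtain ⟨η, hη, hηQ⟩ := hQ ![0, 1] p g
  refine ⟨θ, η, ρ, σ, hθ, hη, fun a x => ?_⟩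
  have hρ' (b) (hb : b ∈ F ∪ F') :
      Function.update (Function.update ρ 0 a) 1 x (p b) = b := by
    obtain ⟨hpb, hρb⟩ := hρ b hb
    rw [Function.update_of_ne (by lia), Function.update_of_ne (by lia), hρb]
  exact ⟨hθP _ σ (fun b hb => hρ' b (Finset.mem_union_left _ hb))
      fun A hA => (hσ A (Finset.mem_union_left _ hA)).2,
    hηQ _ σ (fun b hb => hρ' b (Finset.mem_union_right _ hb))
      fun A hA => (hσ A (Finset.mem_union_right _ hA)).2⟩

variable [hM : Fact M.IsRCA0]

theorem sigma01_induction {P : M.Num → Prop}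
    (hP : M.Sigma01Definable fun v : Fin 1 → M.Num => P (v 0)) (zero : P 0)
    (succ : ∀ a, P a → P (a + 1)) (a : M.Num) : P a := by
  obtain ⟨Q, hQ, hPQ⟩ := hP.exists_matrix
  obtain ⟨θ, _, ρ, σ, hθ, -, h⟩ := exists_bounded_formulas hQ hQ
  have hP (a) : (Formula.ex 1 θ).Holds M (Function.update ρ 0 a) σ ↔ P a :=
    (exists_congr fun x => (h a x).1).trans (hPQ a).symm
  exact (hP a).1 (hM.out.induction _ 0 ⟨1, θ, hθ, rfl⟩ ρ σ ((hP _).2 zero)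
    (fun a ha => (hP _).2 (succ a ((hP a).1 ha))) a)

theorem delta01_comprehension {P : M.Num → Prop}
    (hP : M.Sigma01Definable fun v : Fin 1 → M.Num => P (v 0))
    (hnP : M.Sigma01Definable fun v : Fin 1 → M.Num => ¬ P (v 0)) : {a | P a} ∈ M.sets := by
  obtain ⟨Q, hQ, hPQ⟩ := hP.exists_matrix
  obtain ⟨R, hR, hPR⟩ := hnP.exists_matrix (P := fun a => ¬ P a)
  obtain ⟨θ, η, ρ, σ, hθ, hη, h⟩ := exists_bounded_formulas hQ hR
  have hP (a) : (Formula.ex 1 θ).Holds M (Function.update ρ 0 a) σ ↔ P a :=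
    (exists_congr fun x => (h a x).1).trans (hPQ a).symm
  have hP' (a) : (Formula.all 1 η.neg).Holds M (Function.update ρ 0 a) σ ↔ P a :=
    (forall_congr' fun x => not_congr (h a x).2).trans
      (not_exists.symm.trans ((not_congr (hPR a).symm).trans not_not))
  obtain ⟨X, hX, hXP⟩ := hM.out.comprehension _ _ 0 ⟨1, θ, hθ, rfl⟩ ⟨1, _, .neg hη, rfl⟩ ρ σ
    fun a => (hP a).trans (hP' a).symm
  rwa [show {a | P a} = X from Set.ext fun a => ((hXP a).trans (hP a)).symm]

theorem bounded_comprehension {P : M.Num → Prop}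
    (hP : M.BoundedDefinable fun v : Fin 1 → M.Num => P (v 0)) : {a | P a} ∈ M.sets :=
  delta01_comprehension hP.sigma01 hP.neg.sigma01

end Comprehension

section Subtraction

variable {M : Model.{u}} [hM : Fact M.IsRCA0]

theorem eq_zero_or_eq_add_one (a : M.Num) : a = 0 ∨ ∃ b, a = b + 1 :=
  sigma01_induction (P := fun a => a = 0 ∨ ∃ b, a = b + 1)
    (.or (BoundedDefinable.eq (.var 0) (.const 0)).sigma01
      (.of_exists (P := fun a b => a = b + 1) (.eq (.var 0) (.add (.var 1) (.const 1)))))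
    (Or.inl rfl) (fun a _ => Or.inr ⟨a, rfl⟩) a

theorem lt_or_exists_eq_add (a b : M.Num) : b < a ∨ ∃ c, b = a + c := by
  refine sigma01_induction (P := fun a => b < a ∨ ∃ c, b = a + c)
    (.or (BoundedDefinable.lt (.const b) (.var 0)).sigma01
      (.of_exists (P := fun a c => b = a + c) (.eq (.const b) (.add (.var 0) (.var 1)))))
    (Or.inr ⟨b, (zero_add b).symm⟩) (fun a ha => ?_) a
  rcases ha with hba | ⟨c, rfl⟩
  · exact Or.inl (hba.trans (lt_add_one a))
  · obtain rfl | ⟨d, rfl⟩ := eq_zero_or_eq_add_one c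
    · exact Or.inl (by rw [add_zero]; exact lt_add_one a)
    · exact Or.inr ⟨d, by ring⟩

theorem num_nonneg (a : M.Num) : 0 ≤ a := not_lt.1 (hM.out.basic.not_lt_zero a)

instance : CanonicallyOrderedAdd M.Num where
  exists_add_of_le h := (lt_or_exists_eq_add _ _).resolve_left h.not_gt
  le_add_self _ b := le_add_of_nonneg_left (num_nonneg b)
  le_self_add _ b := le_add_of_nonneg_right (num_nonneg b)

noncomputable instance : SuccAddOrder M.Num where
  toSuccOrder := SuccOrder.ofSuccLeIff (· + 1) fun {a b} => by
    refine ⟨(lt_add_one a).trans_le, fun h => ?_⟩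
    obtain ⟨c, rfl⟩ := exists_add_of_le h.le
    obtain rfl | ⟨d, rfl⟩ := eq_zero_or_eq_add_one c
    · simp at h
    · exact add_le_add_right le_add_self a
  succ_eq_add_one _ := rfl

end Subtraction

section Sigma01

variable {M : Model.{u}} [hM : Fact M.IsRCA0] {n : ℕ}

theorem Sigma01Definable.ex {P : (Fin n → M.Num) → M.Num → Prop}
    (hP : M.Sigma01Definable fun w : Fin (n + 1) → M.Num => P (fun i => w i.succ) (w 0)) :
    M.Sigma01Definable fun v => ∃ a, P v a := by
  obtain ⟨Q, hQ, hPQ⟩ := hP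
  have hPQ (v : Fin n → M.Num) (a : M.Num) : P v a ↔ ∃ x, Q (Fin.cons a v) x := hPQ (Fin.cons a v)
  refine ⟨fun v z => ∃ a, a < z ∧ ∃ x, x < z ∧ Q (Fin.cons a v) x,
    .bex (.var 0) (.bex (.var 1) (hQ.subst_cons (.var 0)
      (.cons (.var 1) fun i => .var i.succ.succ.succ))), fun v => ⟨?_, ?_⟩⟩
  · rintro ⟨a, ha⟩
    obtain ⟨x, hx⟩ := (hPQ v a).1 ha
    exact ⟨a + x + 1, a, Order.lt_add_one_iff.2 le_self_add, x,
      Order.lt_add_one_iff.2 le_add_self, hx⟩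
  · rintro ⟨z, a, -, x, -, hx⟩
    exact ⟨a, (hPQ v a).2 ⟨x, hx⟩⟩

theorem Sigma01Definable.and {P Q : (Fin n → M.Num) → Prop} (hP : M.Sigma01Definable P)
    (hQ : M.Sigma01Definable Q) : M.Sigma01Definable fun v => P v ∧ Q v := by
  obtain ⟨P', hP', hP⟩ := hP
  obtain ⟨Q', hQ', hQ⟩ := hQ
  have hPQ : M.Sigma01Definable fun v => ∃ x, ∃ y, P' v x ∧ Q' v y :=
    .ex (P := fun v x => ∃ y, P' v x ∧ Q' v y) ⟨fun w y => P' (fun i => w i.succ) (w 0) ∧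
      Q' (fun i => w i.succ) y, .and hP'.shift (hQ'.subst_cons (.var 0) fun i => .var i.succ.succ),
      fun w => Iff.rfl⟩
  exact hPQ.congr fun v => by simp only [hP, hQ, exists_and_left, exists_and_right]

theorem Sigma01Definable.bex {f : (Fin n → M.Num) → M.Num} {P : (Fin n → M.Num) → M.Num → Prop}
    (hf : M.TermDefinable f)
    (hP : M.Sigma01Definable fun w : Fin (n + 1) → M.Num => P (fun i => w i.succ) (w 0)) :
    M.Sigma01Definable fun v => ∃ a, a < f v ∧ P v a :=
  .ex ((BoundedDefinable.lt (.var 0) hf.shift).sigma01.and hP)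

theorem collection {P : M.Num → M.Num → Prop}
    (hP : M.BoundedDefinable fun v : Fin 2 → M.Num => P (v 0) (v 1)) {b : M.Num}
    (h : ∀ a, a < b → ∃ x, P a x) : ∃ z, ∀ a, a < b → ∃ x, x < z ∧ P a x := by
  suffices ∀ c, ∃ z, ∀ a, a < c → a < b → ∃ x, x < z ∧ P a x by
    obtain ⟨z, hz⟩ := this b
    exact ⟨z, fun a ha => hz a ha ha⟩
  refine sigma01_induction (P := fun c => ∃ z, ∀ a, a < c → a < b → ∃ x, x < z ∧ P a x)
    (.of_exists (P := fun c z => ∀ a, a < c → a < b → ∃ x, x < z ∧ P a x)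
      (.ball (.var 0) (.imp (.lt (.var 0) (.const b))
        (.bex (.var 2) (hP.comp₂ (.var 1) (.var 0))))))
    ⟨0, fun a ha => absurd ha not_lt_zero⟩ ?_
  rintro c ⟨z, hz⟩
  rcases le_or_gt b c with hbc | hcb
  · exact ⟨z, fun a _ hab => hz a (hab.trans_le hbc) hab⟩
  obtain ⟨y, hy⟩ := h c hcb
  refine ⟨max z (y + 1), fun a ha hab => ?_⟩
  rcases (Order.lt_add_one_iff.1 ha).lt_or_eq with hac | rfl
  · obtain ⟨x, hx, hPx⟩ := hz a hac hab
    exact ⟨x, lt_max_of_lt_left hx, hPx⟩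
  · exact ⟨y, lt_max_of_lt_right (lt_add_one y), hy⟩

theorem Sigma01Definable.ball {f : (Fin n → M.Num) → M.Num} {P : (Fin n → M.Num) → M.Num → Prop}
    (hf : M.TermDefinable f)
    (hP : M.Sigma01Definable fun w : Fin (n + 1) → M.Num => P (fun i => w i.succ) (w 0)) :
    M.Sigma01Definable fun v => ∀ a, a < f v → P v a := by
  obtain ⟨Q, hQ, hPQ⟩ := hP
  have hPQ (v : Fin n → M.Num) (a : M.Num) : P v a ↔ ∃ x, Q (Fin.cons a v) x := hPQ (Fin.cons a v)
  refine ⟨fun v z => ∀ a, a < f v → ∃ x, x < z ∧ Q (Fin.cons a v) x,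
    .ball hf.shift (.bex (.var 1) (hQ.subst_cons (.var 0)
      (.cons (.var 1) fun i => .var i.succ.succ.succ))), fun v => ⟨fun hv => ?_, ?_⟩⟩
  · exact collection (P := fun a x => Q (Fin.cons a v) x)
      (hQ.subst_cons (.var 1) (.cons (.var 0) fun i => .const (v i)))
      fun a ha => (hPQ v a).1 (hv a ha)
  · rintro ⟨z, hz⟩ a ha
    obtain ⟨x, -, hx⟩ := hz a ha
    exact (hPQ v a).2 ⟨x, hx⟩

theorem exists_least_of_pi01 {P : M.Num → Prop}
    (hP : M.Sigma01Definable fun v : Fin 1 → M.Num => ¬ P (v 0)) (h : ∃ a, P a) :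
    ∃ a, P a ∧ ∀ b, b < a → ¬ P b := by
  by_contra! hno
  obtain ⟨a, ha⟩ := h
  refine sigma01_induction (P := fun a => ∀ b, b < a → ¬ P b)
    (.ball (.var 0) (Sigma01Definable.comp₁ (P := fun a => ¬ P a) hP (.var 0)))
    (fun b hb => absurd hb not_lt_zero) (fun c hc b hb hPb => ?_) (a + 1) a (lt_add_one a) ha
  obtain ⟨d, hd, hPd⟩ := hno b hPb
  exact hc d (hd.trans_le (Order.lt_add_one_iff.1 hb)) hPd

theorem exists_least_of_sigma01 {P : M.Num → Prop}
    (hP : M.Sigma01Definable fun v : Fin 1 → M.Num => P (v 0)) (h : ∃ a, P a) :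
    ∃ a, P a ∧ ∀ b, b < a → ¬ P b := by
  by_contra! hno
  obtain ⟨a, ha⟩ := h
  -- Without a least element there would be a descent of any length below `a`.
  have descent : ∀ x, ∃ y, y + x ≤ a ∧ P y := by
    refine sigma01_induction (P := fun x => ∃ y, y + x ≤ a ∧ P y)
      (.ex ((BoundedDefinable.le (.add (.var 0) (.var 1)) (.const a)).sigma01.and
        (hP.comp₁ (.var 0)))) ⟨a, (add_zero a).le, ha⟩ ?_
    rintro x ⟨y, hy, hPy⟩
    obtain ⟨z, hz, hPz⟩ := hno y hPy
    refine ⟨z, le_trans ?_ hy, hPz⟩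
    rw [add_comm x, ← add_assoc]
    exact add_le_add_left (Order.add_one_le_iff.2 hz) x
  obtain ⟨y, hy, -⟩ := descent (a + 1)
  exact (le_add_self.trans hy).not_gt (lt_add_one a)

end Sigma01

section Pairing

variable {M : Model.{u}}

theorem pair_eq [Fact M.BasicAxioms] (a b : M.Num) : M.pair a b = (a + b) * (a + b) + a := rfl

variable [hM : Fact M.IsRCA0] {a b c d : M.Num}

theorem left_le_pair : a ≤ M.pair a b := le_add_self

theorem right_le_pair : b ≤ M.pair a b := by
  rcases eq_zero_or_eq_add_one (a + b) with hab | ⟨c, hc⟩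
  · rw [(add_eq_zero.1 hab).2]
    exact zero_le
  · calc b ≤ a + b := le_add_self
      _ ≤ (a + b) * (a + b) := le_mul_of_one_le_left zero_le (hc ▸ le_add_self)
      _ ≤ M.pair a b := le_self_add

theorem add_le_add_of_pair_le_pair (h : M.pair a b ≤ M.pair c d) : a + b ≤ c + d := by
  by_contra! hlt
  refine h.not_gt ?_
  calc M.pair c d ≤ (c + d) * (c + d) + (c + d) := add_le_add_right le_self_add _
    _ = (c + d + 1) * (c + d) := by ring
    _ < (c + d + 1) * (c + d + 1) := mul_lt_mul_of_pos_left (lt_add_one _) (by simp)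
    _ ≤ (a + b) * (a + b) :=
      mul_le_mul' (Order.add_one_le_iff.2 hlt) (Order.add_one_le_iff.2 hlt)
    _ ≤ M.pair a b := le_self_add

@[simp]
theorem pair_inj : M.pair a b = M.pair c d ↔ a = c ∧ b = d := by
  refine ⟨fun h => ?_, fun ⟨hac, hbd⟩ => hac ▸ hbd ▸ rfl⟩
  have hsum : a + b = c + d :=
    le_antisymm (add_le_add_of_pair_le_pair h.le) (add_le_add_of_pair_le_pair h.ge)
  rw [pair_eq, pair_eq, hsum] at h
  obtain rfl := add_left_cancel h
  exact ⟨rfl, add_left_cancel hsum⟩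

theorem BoundedDefinable.exists_pair {n : ℕ} {f : (Fin n → M.Num) → M.Num}
    {P : (Fin n → M.Num) → M.Num → M.Num → Prop} (hf : M.TermDefinable f)
    (hP : M.BoundedDefinable fun w : Fin (n + 2) → M.Num =>
      P (fun i => w i.succ.succ) (w 1) (w 0)) :
    M.BoundedDefinable fun v => ∃ a b, f v = M.pair a b ∧ P v a b := by
  have hbounded : M.BoundedDefinable fun v =>
      ∃ a, a < f v + 1 ∧ ∃ b, b < f v + 1 ∧ (f v = M.pair a b ∧ P v a b) :=
    .bex (P := fun v a => ∃ b, b < f v + 1 ∧ (f v = M.pair a b ∧ P v a b))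
      (hf.add (.const 1)) (.bex (hf.shift.add (.const 1))
        (.and (.eq hf.shift.shift (.pair (.var 1) (.var 0))) hP))
  refine hbounded.congr fun v => ⟨fun ⟨a, _, b, _, h⟩ => ⟨a, b, h⟩, fun ⟨a, b, h, hab⟩ => ?_⟩
  rw [h]
  exact ⟨a, Order.lt_add_one_iff.2 left_le_pair, b, Order.lt_add_one_iff.2 right_le_pair, rfl, hab⟩

variable (M) in
/-- The set of numbers that codes the binary relation `R`. -/
def relationSet (R : M.Num → M.Num → Prop) : Set M.Num :=
  {z | ∃ a b, z = M.pair a b ∧ R a b}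

@[simp]
theorem pair_mem_relationSet {R : M.Num → M.Num → Prop} :
    M.pair a b ∈ M.relationSet R ↔ R a b := by
  simp [relationSet]

theorem relationSet_mem_sets_iff {R : M.Num → M.Num → Prop} :
    M.relationSet R ∈ M.sets ↔ M.BoundedDefinable fun v : Fin 2 → M.Num => R (v 0) (v 1) :=
  ⟨fun h => (BoundedDefinable.mem (.pair (.var 0) (.var 1)) h).congr fun _ => pair_mem_relationSet,
    fun h => bounded_comprehension (P := fun z => ∃ a b, z = M.pair a b ∧ R a b)
      (.exists_pair (.var 0) (h.comp₂ (.var 1) (.var 0)))⟩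

theorem boundedDefinable_of_delta01 {R : M.Num → M.Num → Prop}
    (hR : M.Sigma01Definable fun v : Fin 2 → M.Num => R (v 0) (v 1))
    (hnR : M.Sigma01Definable fun v : Fin 2 → M.Num => ¬ R (v 0) (v 1)) :
    M.BoundedDefinable fun v : Fin 2 → M.Num => R (v 0) (v 1) := by
  have hpair {S : M.Num → M.Num → Prop}
      (hS : M.Sigma01Definable fun v : Fin 2 → M.Num => S (v 0) (v 1)) :
      M.Sigma01Definable fun v : Fin 1 → M.Num => ∃ a b, v 0 = M.pair a b ∧ S a b :=
    .ex (.ex (.and (BoundedDefinable.eq (.var 2) (.pair (.var 1) (.var 0))).sigma01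
      (hS.comp₂ (.var 1) (.var 0))))
  have hnpair : M.BoundedDefinable fun v : Fin 1 → M.Num => ¬ ∃ a b, v 0 = M.pair a b ∧ True :=
    .neg (.exists_pair (.var 0) (.const True))
  refine relationSet_mem_sets_iff.1 (delta01_comprehension
    (P := fun z => ∃ a b, z = M.pair a b ∧ R a b) (hpair hR)
    ((hnpair.sigma01.or (hpair (S := fun a b => ¬ R a b) hnR)).congr fun v => ?_))
  constructor
  · rintro (h | ⟨a, b, h, hab⟩) ⟨c, d, h', hcd⟩
    · exact h ⟨c, d, h', trivial⟩
    · obtain ⟨rfl, rfl⟩ := pair_inj.1 (h.symm.trans h')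
      exact hab hcd
  · intro h
    by_cases hz : ∃ a b, v 0 = M.pair a b
    · obtain ⟨a, b, hab⟩ := hz
      exact .inr ⟨a, b, hab, fun hR => h ⟨a, b, hab, hR⟩⟩
    · exact .inl fun ⟨a, b, hab, _⟩ => hz ⟨a, b, hab⟩

end Pairing

section Divisibility

variable {M : Model.{u}} [hM : Fact M.IsRCA0]

theorem boundedDefinable_dvd :
    M.BoundedDefinable fun v : Fin 2 → M.Num => v 0 ∣ v 1 := by
  have hbounded : M.BoundedDefinable fun v : Fin 2 → M.Num => ∃ q, q < v 1 + 1 ∧ v 1 = v 0 * q :=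
    .bex (.add (.var 1) (.const 1)) (.eq (.var 2) (.mul (.var 1) (.var 0)))
  refine hbounded.congr fun v => ⟨fun ⟨q, _, h⟩ => ⟨q, h⟩, fun ⟨q, h⟩ => ?_⟩
  rcases eq_zero_or_eq_add_one (v 0) with h0 | ⟨d, hd⟩
  · exact ⟨0, by simp, by rw [h, h0, zero_mul, zero_mul]⟩
  · exact ⟨q, Order.lt_add_one_iff.2 (h ▸ le_mul_of_one_le_left zero_le (hd ▸ le_add_self)), h⟩

theorem dvd_of_dvd_add {p a b : M.Num} (h : p ∣ a + b) (ha : p ∣ a) : p ∣ b := by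
  obtain ⟨x, hx⟩ := h
  obtain ⟨y, rfl⟩ := ha
  rcases le_total y x with hyx | hxy
  · obtain ⟨c, rfl⟩ := exists_add_of_le hyx
    exact ⟨c, add_left_cancel (hx.trans (mul_add p y c))⟩
  · have hle : p * y + b ≤ p * y + 0 := by
      rw [hx, add_zero]
      exact mul_le_mul_right hxy p
    rw [nonpos_iff_eq_zero.1 (le_of_add_le_add_left hle)]
    exact dvd_zero p

theorem exists_common_multiple {f : M.Num → M.Num} (hf : ∀ i, 0 < f i)
    (hfdef : M.TermDefinable fun v : Fin 1 → M.Num => f (v 0)) (k : M.Num) :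
    ∃ m, 0 < m ∧ ∀ i, i < k → f i ∣ m := by
  refine sigma01_induction (P := fun k => ∃ m, 0 < m ∧ ∀ i, i < k → f i ∣ m)
    (.of_exists (P := fun k m => 0 < m ∧ ∀ i, i < k → f i ∣ m) (.and (.lt (.const 0) (.var 1))
      (.ball (.var 0) (boundedDefinable_dvd.comp₂
        (hfdef.subst (τ := fun w _ => w 0) fun _ => .var 0) (.var 2)))))
    ⟨1, zero_lt_one, fun i hi => absurd hi not_lt_zero⟩ ?_ k
  rintro k ⟨m, hm, hdvd⟩
  refine ⟨m * f k, mul_pos hm (hf k), fun i hi => ?_⟩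
  rcases (Order.lt_add_one_iff.1 hi).lt_or_eq with hik | rfl
  · exact (hdvd i hik).mul_right _
  · exact dvd_mul_left _ _

/-- The moduli `m * (i + 1) + 1` for `i < k` are pairwise coprime. -/
theorem modulus_dvd_of_dvd_modulus_mul {m k i j n : M.Num} (hm : ∀ d, 0 < d → d ≤ k → d ∣ m)
    (hi : i < k) (hj : j < k) (hij : i ≠ j)
    (h : m * (j + 1) + 1 ∣ (m * (i + 1) + 1) * n) : m * (j + 1) + 1 ∣ n := by
  -- `d ∣ m` turns the hypothesis into divisibility of `(m * (j + 1)) ^ 2 * n`, and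
  -- `m * (j + 1)` is `-1` modulo `m * (j + 1) + 1`.
  have cancel (d : M.Num) (hd : 0 < d) (hdk : d ≤ k) (hdvd : m * (j + 1) + 1 ∣ m * d * n) :
      m * (j + 1) + 1 ∣ n := by
    obtain ⟨r, hr⟩ := hm d hd hdk
    have hsq : m * (j + 1) + 1 ∣ m * (j + 1) * (d * r * (j + 1)) * n := by
      convert hdvd.mul_left (r * (j + 1) * (j + 1)) using 1
      ring
    rw [← hr] at hsq
    refine dvd_of_dvd_add (a := (m * (j + 1) + 1) * ((m * (j + 1) + 1) * n)) ?_
      (dvd_mul_right _ _)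
    convert dvd_add hsq (dvd_mul_right (m * (j + 1) + 1) (2 * n)) using 1
    ring
  rcases lt_or_gt_of_ne hij with hlt | hlt
  · obtain ⟨d, rfl⟩ := exists_add_of_le hlt.le
    refine cancel d (pos_of_lt_add_right hlt) (le_add_self.trans hj.le) (dvd_of_dvd_add ?_ h)
    exact ⟨n, by ring⟩
  · obtain ⟨d, rfl⟩ := exists_add_of_le hlt.le
    refine cancel d (pos_of_lt_add_right hlt) (le_add_self.trans hi.le)
      (dvd_of_dvd_add ?_ (dvd_mul_right _ n))
    convert h using 1
    ring

theorem exists_modulus_dvd_iff {P : M.Num → Prop}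
    (hP : M.Sigma01Definable fun v : Fin 1 → M.Num => P (v 0)) (k : M.Num) :
    ∃ m n, ∀ i, i < k → (m * (i + 1) + 1 ∣ n ↔ P i) := by
  obtain ⟨m, hm0, hm⟩ := exists_common_multiple (f := (· + 1)) (fun i => by simp)
    (.add (.var 0) (.const 1)) k
  have hdvd_m (d) (hd : 0 < d) (hdk : d ≤ k) : d ∣ m := by
    obtain rfl | ⟨i, rfl⟩ := eq_zero_or_eq_add_one d
    · exact absurd hd (lt_irrefl _)
    · exact hm i (Order.add_one_le_iff.1 hdk)
  have hmod (j : Fin 1) : M.TermDefinable fun v : Fin 1 → M.Num => m * (v j + 1) + 1 :=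
    .add (.mul (.const m) (.add (.var j) (.const 1))) (.const 1)
  obtain ⟨N, hN0, hN⟩ := exists_common_multiple (f := fun i => m * (i + 1) + 1)
    (fun i => by simp) (hmod 0) k
  have hpi : M.Sigma01Definable fun v : Fin 1 → M.Num =>
      v 0 ≤ 0 ∨ ∃ i, i < k ∧ (P i ∧ ¬ m * (i + 1) + 1 ∣ v 0) :=
    .or (BoundedDefinable.le (.var 0) (.const 0)).sigma01 (.bex (.const k)
      (.and (hP.comp₁ (.var 0)) (BoundedDefinable.neg (boundedDefinable_dvd.comp₂
        (.add (.mul (.const m) (.add (.var 0) (.const 1))) (.const 1)) (.var 1))).sigma01))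
  obtain ⟨n, ⟨hn0, hn⟩, hleast⟩ := exists_least_of_pi01
    (P := fun n => 0 < n ∧ ∀ i, i < k → P i → m * (i + 1) + 1 ∣ n)
    (hpi.congr fun v => by simp only [not_and_or, not_lt, not_forall, exists_prop])
    ⟨N, hN0, fun i hi _ => hN i hi⟩
  refine ⟨m, n, fun i hi => ⟨fun hdvd => ?_, hn i hi⟩⟩
  -- If `P i` fails, dividing `n` by the modulus of `i` gives a smaller common multiple.
  by_contra hPi
  obtain ⟨q, rfl⟩ := hdvd
  have hq0 : 0 < q := pos_of_mul_pos_right hn0 zero_le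
  refine hleast q ?_ ⟨hq0, fun j hj hPj => modulus_dvd_of_dvd_modulus_mul hdvd_m hi hj
    (fun hij => hPi (hij ▸ hPj)) (hn j hj hPj)⟩
  exact lt_mul_of_one_lt_left hq0 (lt_add_of_pos_left _ (mul_pos hm0 (by simp)))

end Divisibility

section FiniteSets

variable {M : Model.{u}} [hM : Fact M.IsRCA0]

theorem finMem_triple {a k m n : M.Num} :
    M.FinMem a (M.pair (M.pair k m) n) ↔ a < k ∧ m * (a + 1) + 1 ∣ n := by
  constructor
  · rintro ⟨k', m', n', h, ha, q, hq⟩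
    obtain ⟨hkm, rfl⟩ := pair_inj.1 h
    obtain ⟨rfl, rfl⟩ := pair_inj.1 hkm
    exact ⟨ha, q, hq.symm.trans (mul_comm q _)⟩
  · rintro ⟨ha, q, hq⟩
    exact ⟨k, m, n, rfl, ha, q, (mul_comm q _).trans hq.symm⟩

theorem FinMem.lt {a c : M.Num} (h : M.FinMem a c) : a < c := by
  obtain ⟨k, m, n, rfl, ha, -⟩ := h
  exact lt_of_lt_of_le ha (left_le_pair.trans left_le_pair)

theorem BoundedDefinable.exists_triple {n : ℕ} {f : (Fin n → M.Num) → M.Num}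
    {P : (Fin n → M.Num) → M.Num → M.Num → M.Num → Prop} (hf : M.TermDefinable f)
    (hP : M.BoundedDefinable fun w : Fin (n + 4) → M.Num =>
      P (fun i => w i.succ.succ.succ.succ) (w 1) (w 0) (w 2)) :
    M.BoundedDefinable fun v => ∃ k m n, f v = M.pair (M.pair k m) n ∧ P v k m n := by
  have hpairs : M.BoundedDefinable fun v =>
      ∃ p n, f v = M.pair p n ∧ ∃ k m, p = M.pair k m ∧ P v k m n :=
    .exists_pair (P := fun v p n => ∃ k m, p = M.pair k m ∧ P v k m n) hf (.exists_pair (.var 1) hP)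
  refine hpairs.congr fun v => ⟨?_, ?_⟩
  · rintro ⟨_, n, hn, k, m, rfl, h⟩
    exact ⟨k, m, n, hn, h⟩
  · rintro ⟨k, m, n, hn, h⟩
    exact ⟨_, n, hn, k, m, rfl, h⟩

theorem boundedDefinable_finMem :
    M.BoundedDefinable fun v : Fin 2 → M.Num => M.FinMem (v 0) (v 1) := by
  have htriple : M.BoundedDefinable fun v : Fin 2 → M.Num => ∃ k m n,
      v 1 = M.pair (M.pair k m) n ∧ (v 0 < k ∧ m * (v 0 + 1) + 1 ∣ n) :=
    .exists_triple (P := fun v k m n => v 0 < k ∧ m * (v 0 + 1) + 1 ∣ n) (.var 1)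
      (.and (.lt (.var 4) (.var 1)) (boundedDefinable_dvd.comp₂
        (.add (.mul (.var 0) (.add (.var 4) (.const 1))) (.const 1)) (.var 2)))
  refine htriple.congr fun v => ⟨?_, ?_⟩
  · rintro ⟨k, m, n, h, hmem⟩
    exact h ▸ finMem_triple.2 hmem
  · rintro ⟨k, m, n, h, hmem⟩
    exact ⟨k, m, n, h, finMem_triple.1 (h ▸ ⟨k, m, n, h, hmem⟩)⟩

variable (M) in
/-- `c` is a number of the form `((k, m), n)`, the form that codes of finite sets have. -/
def IsTriple (c : M.Num) : Prop := ∃ k m n, c = M.pair (M.pair k m) n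

theorem boundedDefinable_isTriple :
    M.BoundedDefinable fun v : Fin 1 → M.Num => M.IsTriple (v 0) :=
  (BoundedDefinable.exists_triple (P := fun _ _ _ _ => True) (.var 0) (.const True)).congr
    fun v => by simp only [and_true, IsTriple]

theorem forall_finMem_iff_of_le {c d b : M.Num} (hc : c ≤ b) (hd : d ≤ b) :
    (∀ a, a < b → (M.FinMem a c ↔ M.FinMem a d)) ↔ ∀ a, M.FinMem a c ↔ M.FinMem a d := by
  refine ⟨fun h a => ?_, fun h a _ => h a⟩
  by_cases ha : a < b
  · exact h a ha
  · exact iff_of_false (fun h => ha (h.lt.trans_le hc)) fun h => ha (h.lt.trans_le hd)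

theorem isFinCode_iff {c : M.Num} : M.IsFinCode c ↔ M.IsTriple c ∧
    ∀ d, d < c → M.IsTriple d → ¬ ∀ a, a < c → (M.FinMem a d ↔ M.FinMem a c) := by
  refine and_congr_right fun _ => ⟨?_, fun h k m n hlt => ?_⟩
  · rintro h d hlt ⟨k, m, n, rfl⟩
    rw [forall_finMem_iff_of_le hlt.le le_rfl]
    exact h k m n hlt
  · rw [← forall_finMem_iff_of_le (le_of_lt hlt) le_rfl]
    exact h _ hlt ⟨k, m, n, rfl⟩

theorem boundedDefinable_isFinCode :
    M.BoundedDefinable fun v : Fin 1 → M.Num => M.IsFinCode (v 0) := by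
  have hbounded : M.BoundedDefinable fun v : Fin 1 → M.Num => M.IsTriple (v 0) ∧
      ∀ d, d < v 0 → M.IsTriple d → ¬ ∀ a, a < v 0 → (M.FinMem a d ↔ M.FinMem a (v 0)) :=
    .and boundedDefinable_isTriple (.ball
      (P := fun v d => M.IsTriple d → ¬ ∀ a, a < v 0 → (M.FinMem a d ↔ M.FinMem a (v 0)))
      (.var 0) (.imp (boundedDefinable_isTriple.comp₁ (.var 0))
        (.neg (.ball (.var 1) (.iff (boundedDefinable_finMem.comp₂ (.var 0) (.var 1))
          (boundedDefinable_finMem.comp₂ (.var 0) (.var 2)))))))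
  exact hbounded.congr fun _ => isFinCode_iff.symm

theorem IsTriple.exists_isFinCode {c : M.Num} (hc : M.IsTriple c) :
    ∃ d, M.IsFinCode d ∧ ∀ a, M.FinMem a d ↔ M.FinMem a c := by
  have hdef : M.BoundedDefinable fun v : Fin 1 → M.Num =>
      M.IsTriple (v 0) ∧ ∀ a, a < v 0 + c → (M.FinMem a (v 0) ↔ M.FinMem a c) :=
    .and boundedDefinable_isTriple (.ball (.add (.var 0) (.const c))
      (.iff (boundedDefinable_finMem.comp₂ (.var 0) (.var 1))
        (boundedDefinable_finMem.comp₂ (.var 0) (.const c))))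
  obtain ⟨d, ⟨hd, hdc⟩, hleast⟩ := exists_least_of_sigma01
    (P := fun d => M.IsTriple d ∧ ∀ a, M.FinMem a d ↔ M.FinMem a c)
    (hdef.congr fun v => by rw [forall_finMem_iff_of_le le_self_add le_add_self]).sigma01
    ⟨c, hc, fun _ => Iff.rfl⟩
  refine ⟨d, ⟨hd, fun k m n hlt h => ?_⟩, hdc⟩
  exact hleast _ hlt ⟨⟨k, m, n, rfl⟩, fun a => (h a).trans (hdc a)⟩

theorem IsFinCode.ext {c d : M.Num} (hc : M.IsFinCode c) (hd : M.IsFinCode d)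
    (h : ∀ a, M.FinMem a c ↔ M.FinMem a d) : c = d := by
  obtain ⟨k, m, n, rfl⟩ := hc.1
  obtain ⟨k', m', n', rfl⟩ := hd.1
  rcases lt_trichotomy (M.pair (M.pair k m) n) (M.pair (M.pair k' m') n') with hlt | heq | hlt
  · exact absurd h (hd.2 k m n hlt)
  · exact heq
  · exact absurd (fun a => (h a).symm) (hc.2 k' m' n' hlt)

theorem exists_finCode {P : M.Num → Prop}
    (hP : M.Sigma01Definable fun v : Fin 1 → M.Num => P (v 0)) (k : M.Num) :
    ∃ c, M.IsFinCode c ∧ ∀ a, M.FinMem a c ↔ a < k ∧ P a := by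
  obtain ⟨m, n, hmn⟩ := exists_modulus_dvd_iff hP k
  obtain ⟨c, hc, hcmem⟩ := IsTriple.exists_isFinCode ⟨k, m, n, rfl⟩
  exact ⟨c, hc, fun a => by rw [hcmem, finMem_triple, and_congr_right (hmn a)]⟩

theorem strong_collection {P : M.Num → M.Num → Prop}
    (hP : M.BoundedDefinable fun v : Fin 2 → M.Num => P (v 0) (v 1)) (b : M.Num) :
    ∃ z, ∀ a, a < b → (∃ x, P a x) → ∃ x, x < z ∧ P a x := by
  obtain ⟨c, -, hc⟩ := exists_finCode (P := fun a => ∃ x, P a x) (.of_exists hP) b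
  have hdef : M.BoundedDefinable fun v : Fin 2 → M.Num => M.FinMem (v 0) c → P (v 0) (v 1) :=
    .imp (boundedDefinable_finMem.comp₂ (.var 0) (.const c)) hP
  obtain ⟨z, hz⟩ := collection (P := fun a x => M.FinMem a c → P a x) hdef (b := b) fun a _ => by
    by_cases hx : ∃ x, P a x
    · exact hx.imp fun x hPx _ => hPx
    · exact ⟨0, fun hac => absurd ((hc a).1 hac).2 hx⟩
  refine ⟨z, fun a ha hx => ?_⟩
  obtain ⟨x, hxz, hPx⟩ := hz a ha
  exact ⟨x, hxz, hPx ((hc a).2 ⟨ha, hx⟩)⟩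

end FiniteSets

section ArithmeticalComprehension

variable {M : Model.{u}} [hM : Fact M.IsRCA0] {n : ℕ}

variable (M) in
/-- The `Σ⁰₁` comprehension scheme, for unary predicates. -/
def Sigma01Comprehension : Prop :=
  ∀ P : M.Num → Prop, (M.Sigma01Definable fun v : Fin 1 → M.Num => P (v 0)) → {a | P a} ∈ M.sets

theorem IsACA0.sigma01Comprehension (h : M.IsACA0) :
    M.Sigma01Comprehension := by
  intro P hP
  obtain ⟨Q, hQ, hPQ⟩ := hP.exists_matrix
  obtain ⟨θ, _, ρ, σ, hθ, -, hθQ⟩ := exists_bounded_formulas hQ hQ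
  obtain ⟨X, hX, hXP⟩ := h.comprehension (.ex 1 θ) 0 hθ.isArithmetical ρ σ
  have hset : {a | P a} = X := Set.ext fun a =>
    (hPQ a).trans ((exists_congr fun x => (hθQ a x).1.symm).trans (hXP a).symm)
  exact hset ▸ hX

theorem Sigma01Comprehension.boundedDefinable (hc : M.Sigma01Comprehension)
    {P : (Fin n → M.Num) → Prop} (hP : M.Sigma01Definable P) : M.BoundedDefinable P := by
  induction n using Nat.twoStepInduction with
  | zero => exact (BoundedDefinable.const (P Fin.elim0)).congr fun v => by rw [Subsingleton.elim v]
  | one =>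
    have hset := hc (fun a => P fun _ => a)
      (hP.subst (τ := fun v _ => v 0) fun _ => .var 0)
    refine (BoundedDefinable.mem (.var 0) hset).congr fun v => ?_
    have hv : (fun _ => v 0) = v := funext fun i => by rw [Fin.fin_one_eq_zero i]
    rw [Set.mem_ofPred_eq, hv]
  | more n _ ih =>
    have hpair : M.BoundedDefinable fun w : Fin (n + 1) → M.Num =>
        ∃ a b, w 0 = M.pair a b ∧ P (Fin.cons a (Fin.cons b fun i => w i.succ)) :=
      ih (.ex (P := fun w a => ∃ b, w 0 = M.pair a b ∧
        P (Fin.cons a (Fin.cons b fun i => w i.succ))) (.ex (.and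
        (BoundedDefinable.eq (.var 2) (.pair (.var 1) (.var 0))).sigma01
        (hP.subst (.cons (.var 1) (.cons (.var 0) fun i => .var i.succ.succ.succ))))))
    refine (hpair.subst (τ := fun v => Fin.cons (M.pair (v 0) (v 1)) fun i => v i.succ.succ)
      (.cons (.pair (.var 0) (.var 1)) fun i => .var i.succ.succ)).congr fun v => ?_
    have hv : Fin.cons (v 0) (Fin.cons (v 1) fun i => v i.succ.succ) = v :=
      (congrArg _ (Fin.cons_self_tail (Fin.tail v))).trans (Fin.cons_self_tail v)
    simp only [Fin.cons_zero, Fin.cons_succ, pair_inj]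
    refine ⟨?_, fun h => ⟨v 0, v 1, ⟨rfl, rfl⟩, hv.symm ▸ h⟩⟩
    rintro ⟨_, _, ⟨rfl, rfl⟩, h⟩
    exact hv ▸ h

theorem Sigma01Comprehension.boundedDefinable_holds (hc : M.Sigma01Comprehension)
    {φ : Formula} (hφ : φ.IsArithmetical) (σ : ℕ → M.sets) {τ : (Fin n → M.Num) → ℕ → M.Num}
    (hτ : ∀ i, M.TermDefinable fun v => τ v i) :
    M.BoundedDefinable fun v => φ.Holds M (τ v) σ := by
  induction φ generalizing n with
  | eq s t => exact .eq (.eval s hτ) (.eval t hτ)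
  | lt s t => exact .lt (.eval s hτ) (.eval t hτ)
  | mem t X => exact .mem (.eval t hτ) (σ X).2
  | neg φ ih => exact .neg (ih hφ hτ)
  | and φ ψ ih₁ ih₂ => exact .and (ih₁ hφ.1 hτ) (ih₂ hφ.2 hτ)
  | or φ ψ ih₁ ih₂ => exact .or (ih₁ hφ.1 hτ) (ih₂ hφ.2 hτ)
  | imp φ ψ ih₁ ih₂ => exact .imp (ih₁ hφ.1 hτ) (ih₂ hφ.2 hτ)
  | all i φ ih =>
    have hex : M.BoundedDefinable fun v => ∃ a, ¬ φ.Holds M (Function.update (τ v) i a) σ :=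
      hc.boundedDefinable (.ex (ih hφ (.update (fun j => (hτ j).shift) (.var 0) i)).neg.sigma01)
    exact hex.neg.congr fun v => not_exists_not
  | ex i φ ih =>
    exact hc.boundedDefinable (.ex (P := fun v a => φ.Holds M (Function.update (τ v) i a) σ)
      (ih hφ (.update (fun j => (hτ j).shift) (.var 0) i)).sigma01)
  | allSet | exSet => exact hφ.elim

theorem Sigma01Comprehension.isACA0 (hc : M.Sigma01Comprehension) : M.IsACA0 where
  basic := hM.out.basic
  induction X hX zero succ := sigma01_induction (P := (· ∈ X))
    (BoundedDefinable.mem (.var 0) hX).sigma01 zero succ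
  comprehension φ i hφ ρ σ :=
    ⟨{a | φ.Holds M (Function.update ρ i a) σ}, bounded_comprehension
      (hc.boundedDefinable_holds hφ σ (.update (fun j => .const (ρ j)) (.var 0) i)),
      fun _ => Iff.rfl⟩

end ArithmeticalComprehension

section EffectivelyClosed

variable {M : Model.{u}} [hM : Fact M.IsRCA0]

theorem boundedDefinable_isFinCode_of {P : M.Num → M.Num → Prop}
    (hP : M.BoundedDefinable fun v : Fin 2 → M.Num => P (v 0) (v 1)) {f : M.Num → M.Num}
    (hf : M.TermDefinable fun v : Fin 1 → M.Num => f (v 0)) (hlt : ∀ n a, P n a → a < f n) :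
    M.BoundedDefinable fun v : Fin 2 → M.Num =>
      M.IsFinCode (v 1) ∧ ∀ a, M.FinMem a (v 1) ↔ P (v 0) a := by
  have hbounded : M.BoundedDefinable fun v : Fin 2 → M.Num => M.IsFinCode (v 1) ∧
      ∀ a, a < v 1 + f (v 0) → (M.FinMem a (v 1) ↔ P (v 0) a) :=
    .and (boundedDefinable_isFinCode.comp₁ (.var 1)) (.ball
      (.add (.var 1) (hf.subst (τ := fun v _ => v 0) fun _ => .var 0))
      ((boundedDefinable_finMem.comp₂ (.var 0) (.var 2)).iff (hP.comp₂ (.var 1) (.var 0))))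
  refine hbounded.congr fun v => and_congr_right fun _ => ⟨fun h a => ?_, fun h a _ => h a⟩
  by_cases ha : a < v 1 + f (v 0)
  · exact h a ha
  · exact iff_of_false (fun h => ha (h.lt.trans_le le_self_add))
      fun h => ha ((hlt _ a h).trans_le le_add_self)

/-- The code is the function that sends `i ∈ U` to `{i}` and every other number to `∅`. -/
theorem exists_closed_code {Q U : Set M.Num} (hU : U ∈ M.sets) (hUQ : U ⊆ M.Pf Q) :
    ∃ h ∈ M.sets, M.IsFunction h Set.univ (M.Pf (M.Pf Q)) ∧
      ∀ R X, M.FlatInClosed R h X ↔ ∀ i ∈ U, ¬ M.FlatInBasic R X i := by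
  let IsValue (n c : M.Num) : Prop := M.IsFinCode c ∧ ∀ i, M.FinMem i c ↔ i = n ∧ n ∈ U
  have hdef : M.relationSet IsValue ∈ M.sets :=
    relationSet_mem_sets_iff.2 (boundedDefinable_isFinCode_of (P := fun n i => i = n ∧ n ∈ U)
      (.and (.eq (.var 1) (.var 0)) (.mem (.var 0) hU)) (f := (· + 1)) (.add (.var 0) (.const 1))
      fun n i hi => hi.1 ▸ lt_add_one n)
  have hexists (n : M.Num) : ∃ c, IsValue n c := by
    obtain ⟨c, hc, hcmem⟩ := exists_finCode (P := fun i => i = n ∧ n ∈ U)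
      (BoundedDefinable.and (.eq (.var 0) (.const n)) (.const _)).sigma01 (n + 1)
    refine ⟨c, hc, fun i => (hcmem i).trans (and_iff_right_of_imp fun hi => ?_)⟩
    exact hi.1 ▸ lt_add_one n
  refine ⟨_, hdef, ⟨?_, fun n _ => ?_⟩, fun R X => ⟨fun hX i hi => ?_, ?_⟩⟩
  · rintro _ ⟨n, c, rfl, hc, hcmem⟩
    refine ⟨n, trivial, c, ⟨hc, fun i hi => ?_⟩, rfl⟩
    obtain ⟨rfl, hiU⟩ := (hcmem i).1 hi
    exact hUQ hiU
  · obtain ⟨c, hc⟩ := hexists n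
    refine ⟨c, pair_mem_relationSet.2 hc, fun d hd => ?_⟩
    obtain ⟨hd, hdmem⟩ := pair_mem_relationSet.1 hd
    exact hd.ext hc.1 fun i => (hdmem i).trans (hc.2 i).symm
  · obtain ⟨c, hc⟩ := hexists i
    exact hX i c (pair_mem_relationSet.2 hc) i ((hc.2 i).2 ⟨rfl, hi⟩)
  · intro hX n c hc i hi
    obtain ⟨rfl, hiU⟩ := ((pair_mem_relationSet.1 hc).2 i).1 hi
    exact hX i hiU

theorem IsQuasiOrder.flatLE_iff {Q R E X : Set M.Num} (hQ : M.IsQuasiOrder Q R) (hE : E ⊆ Q)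
    (hX : X ⊆ Q) : M.FlatLE R X E ↔ ∀ i ∈ M.Pf Q, (∃ q, M.FinMem q i ∧ ∀ e ∈ E, M.pair q e ∉ R) →
      ¬ M.FlatInBasic R X i := by
  constructor
  · rintro hXE i hi ⟨q, hqi, hqE⟩ hXi
    obtain ⟨x, hx, hqx⟩ := hXi q hqi
    obtain ⟨e, he, hxe⟩ := hXE x hx
    exact hqE e he (hQ.trans q (hi.2 q hqi) x (hX hx) e (hE he) hqx hxe)
  · intro h x hx
    by_contra! hxE
    obtain ⟨i, hi, himem⟩ := exists_finCode (P := (· = x))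
      (BoundedDefinable.eq (.var 0) (.const x)).sigma01 (x + 1)
    refine h i ⟨hi, fun q hq => ((himem q).1 hq).2 ▸ hX hx⟩
      ⟨x, (himem x).2 ⟨lt_add_one x, rfl⟩, hxE⟩ fun q hq => ⟨x, hx, ?_⟩
    exact ((himem q).1 hq).2 ▸ hQ.refl x (hX hx)

theorem Sigma01Comprehension.flatClosedForQuasiOrders (hc : M.Sigma01Comprehension) :
    M.FlatClosedForQuasiOrders := by
  intro Q R E hQ hE hEQ
  have hbelow : M.BoundedDefinable fun v : Fin 1 → M.Num => ∃ e, e ∈ E ∧ M.pair (v 0) e ∈ R :=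
    hc.boundedDefinable (.of_exists (P := fun q e => e ∈ E ∧ M.pair q e ∈ R)
      (.and (.mem (.var 1) hE) (.mem (.pair (.var 0) (.var 1)) hQ.rel_mem)))
  have hU : {i | M.IsFinCode i ∧ (∀ q, q < i → M.FinMem q i → q ∈ Q) ∧
      ∃ q, q < i ∧ (M.FinMem q i ∧ ¬ ∃ e, e ∈ E ∧ M.pair q e ∈ R)} ∈ M.sets :=
    bounded_comprehension (.and boundedDefinable_isFinCode (.and
      (.ball (.var 0) (.imp (boundedDefinable_finMem.comp₂ (.var 0) (.var 1))
        (.mem (.var 0) hQ.carrier_mem)))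
      (.bex (P := fun v q => M.FinMem q (v 0) ∧ ¬ ∃ e, e ∈ E ∧ M.pair q e ∈ R) (.var 0)
        (.and (boundedDefinable_finMem.comp₂ (.var 0) (.var 1))
          (BoundedDefinable.comp₁ (P := fun q => ∃ e, e ∈ E ∧ M.pair q e ∈ R)
            hbelow (.var 0)).neg))))
  obtain ⟨h, hh, hfun, hclosed⟩ := exists_closed_code hU
    fun i hi => ⟨hi.1, fun q hq => hi.2.1 q hq.lt hq⟩
  refine ⟨h, hh, hfun, fun X _ hX => (hQ.flatLE_iff hEQ hX).trans (Iff.symm ?_)⟩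
  refine (hclosed R X).trans ⟨fun hXU i hi ⟨q, hq, hqE⟩ => ?_, fun hXU i hi => ?_⟩
  · exact hXU i ⟨hi.1, fun q _ => hi.2 q, q, hq.lt, hq, fun ⟨e, he, hqe⟩ => hqE e he hqe⟩
  · obtain ⟨hi, hiQ, q, -, hq, hqE⟩ := hi
    exact hXU i ⟨hi, fun q hq => hiQ q hq.lt hq⟩ ⟨q, hq, fun e he hqe => hqE ⟨e, he, hqe⟩⟩

end EffectivelyClosed

end Model

section StageOrder

variable {α β : Type*} [LinearOrder α] [LinearOrder β] {f : α → β} {a b c : α}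

/-- The stage `a` of the enumeration `f` is seen to be false at the stage `b`: a value smaller
than `f a` has been enumerated after stage `a` and by stage `b`. -/
def FalseAt (f : α → β) (a b : α) : Prop := ∃ k, a < k ∧ k ≤ b ∧ f k < f a

/-- The stage `a` of the enumeration `f` is true: no value smaller than `f a` is enumerated
later. -/
def TrueStage (f : α → β) (a : α) : Prop := ∀ k, a < k → f a ≤ f k

/-- The linear order of the stages of the enumeration `f`: a stage lies below a later one exactly
if it is false at the later one. -/
def StageLE (f : α → β) (a b : α) : Prop := (a < b ∧ FalseAt f a b) ∨ (b ≤ a ∧ ¬ FalseAt f b a)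

theorem FalseAt.lt (h : FalseAt f a b) : a < b := by
  obtain ⟨k, hak, hkb, -⟩ := h
  exact hak.trans_le hkb

theorem FalseAt.mono (h : FalseAt f a b) (hbc : b ≤ c) : FalseAt f a c := by
  obtain ⟨k, hak, hkb, hlt⟩ := h
  exact ⟨k, hak, hkb.trans hbc, hlt⟩

theorem FalseAt.split (h : FalseAt f a c) (hab : a ≤ b) : FalseAt f a b ∨ FalseAt f b c := by
  obtain ⟨k, hak, hkc, hlt⟩ := h
  rcases le_or_gt k b with hkb | hbk
  · exact .inl ⟨k, hak, hkb, hlt⟩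
  rcases le_or_gt (f a) (f b) with hle | hgt
  · exact .inr ⟨k, hbk, hkc, hlt.trans_le hle⟩
  · exact .inl ⟨b, hab.lt_of_ne fun h => hgt.ne' (congrArg f h), le_rfl, hgt⟩

theorem exists_falseAt_of_not_trueStage (h : ¬ TrueStage f a) : ∃ k, FalseAt f a k := by
  simp only [TrueStage, not_forall, not_le] at h
  obtain ⟨k, hak, hlt⟩ := h
  exact ⟨k, k, hak, le_rfl, hlt⟩

theorem TrueStage.not_falseAt (h : TrueStage f a) : ¬ FalseAt f a b := by
  rintro ⟨k, hak, -, hlt⟩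
  exact (h k hak).not_gt hlt

instance : Std.Refl (StageLE f) where
  refl _ := .inr ⟨le_rfl, fun h => h.lt.false⟩

theorem StageLE.total (a b : α) : StageLE f a b ∨ StageLE f b a := by
  by_cases hab : FalseAt f a b
  · exact .inl (.inl ⟨hab.lt, hab⟩)
  by_cases hba : FalseAt f b a
  · exact .inr (.inl ⟨hba.lt, hba⟩)
  · exact (le_total a b).symm.imp (fun h => .inr ⟨h, hba⟩) fun h => .inr ⟨h, hab⟩

theorem StageLE.antisymm (hab : StageLE f a b) (hba : StageLE f b a) : a = b := by
  rcases hab with ⟨hab, hF⟩ | ⟨hle, hF⟩ <;> rcases hba with ⟨hba, hF'⟩ | ⟨hle', hF'⟩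
  · exact absurd hab hba.not_gt
  · exact absurd hF hF'
  · exact absurd hF' hF
  · exact le_antisymm hle' hle

instance : IsTrans α (StageLE f) where
  trans a b c hab hbc := by
    rcases hab with ⟨hlt, hFab⟩ | ⟨hba, hFba⟩ <;> rcases hbc with ⟨hbc, hFbc⟩ | ⟨hcb, hFcb⟩
    · exact .inl ⟨hlt.trans hbc, hFab.mono hbc.le⟩
    · rcases lt_or_ge a c with hac | hca
      · exact .inl ⟨hac, (hFab.split hac.le).resolve_right hFcb⟩
      · exact .inr ⟨hca, fun hF => hFcb (hF.mono hlt.le)⟩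
    · rcases lt_or_ge a c with hac | hca
      · exact .inl ⟨hac, (hFbc.split hba).resolve_left hFba⟩
      · exact absurd (hFbc.mono hca) hFba
    · exact .inr ⟨hcb.trans hba, fun hF => (hF.split hcb).elim hFcb hFba⟩

theorem FalseAt.lt_of_stageLE (h : FalseAt f a c) (hba : StageLE f b a) : b < c := by
  rcases hba with ⟨hba, -⟩ | ⟨-, hF⟩
  · exact hba.trans h.lt
  · exact lt_of_not_ge fun hcb => hF (h.mono hcb)

end StageOrder

namespace Model

section InternalFunctions

variable {M : Model.{u}} [hM : Fact M.IsRCA0]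

variable (M) in
/-- The function `f` belongs to the model: its graph is a set of `M`. -/
def IsInternal (f : M.Num → M.Num) : Prop := M.relationSet (fun a b => f a = b) ∈ M.sets

variable {f : M.Num → M.Num}

theorem IsInternal.boundedDefinable_apply_eq (hf : M.IsInternal f) {n : ℕ}
    {g h : (Fin n → M.Num) → M.Num} (hg : M.TermDefinable g) (hh : M.TermDefinable h) :
    M.BoundedDefinable fun v => f (g v) = h v :=
  .comp₂ (P := fun a b => f a = b) (relationSet_mem_sets_iff.1 hf) hg hh

theorem IsInternal.sigma01Definable_mem_range (hf : M.IsInternal f) :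
    M.Sigma01Definable fun v : Fin 1 → M.Num => v 0 ∈ Set.range f :=
  .of_exists (P := fun b a => f a = b) (hf.boundedDefinable_apply_eq (.var 1) (.var 0))

theorem IsInternal.boundedDefinable_comp (hf : M.IsInternal f) {R : M.Num → M.Num → Prop}
    (hR : M.BoundedDefinable fun v : Fin 2 → M.Num => R (v 0) (v 1)) :
    M.BoundedDefinable fun v : Fin 2 → M.Num => R (f (v 0)) (v 1) := by
  have hsigma {S : M.Num → M.Num → Prop}
      (hS : M.BoundedDefinable fun v : Fin 2 → M.Num => S (v 0) (v 1)) :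
      M.Sigma01Definable fun v : Fin 2 → M.Num => S (f (v 0)) (v 1) := by
    have hex : M.Sigma01Definable fun v : Fin 2 → M.Num => ∃ b, f (v 0) = b ∧ S b (v 1) :=
      .ex ((hf.boundedDefinable_apply_eq (.var 1) (.var 0)).and
        (hS.comp₂ (.var 0) (.var 2))).sigma01
    exact hex.congr fun v => exists_eq_left'
  exact boundedDefinable_of_delta01 (R := fun a b => R (f a) b) (hsigma hR)
    (hsigma (S := fun a b => ¬ R a b) hR.neg)

theorem IsInternal.boundedDefinable_lt (hf : M.IsInternal f) :
    M.BoundedDefinable fun v : Fin 2 → M.Num => f (v 0) < f (v 1) := by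
  have hlt : M.BoundedDefinable fun v : Fin 2 → M.Num => f (v 0) < v 1 :=
    hf.boundedDefinable_comp (R := (· < ·)) (.lt (.var 0) (.var 1))
  have hgt : M.BoundedDefinable fun v : Fin 2 → M.Num => f (v 1) < f (v 0) :=
    hf.boundedDefinable_comp (R := fun b a => f a < b)
      (.comp₂ (P := fun a b => f a < b) hlt (.var 1) (.var 0))
  exact .comp₂ (P := fun b a => f a < f b) hgt (.var 1) (.var 0)

theorem IsInternal.exists_forall_lt (hf : M.IsInternal f) (hinj : Function.Injective f)
    (b : M.Num) : ∃ s, ∀ k, s ≤ k → b < f k := by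
  obtain ⟨s, hs⟩ := strong_collection (P := fun a x => f x = a)
    (hf.boundedDefinable_apply_eq (.var 1) (.var 0)) (b + 1)
  refine ⟨s, fun k hsk => ?_⟩
  by_contra! hkb
  obtain ⟨x, hxs, hx⟩ := hs (f k) (Order.lt_add_one_iff.2 hkb) ⟨k, rfl⟩
  exact (hinj hx ▸ hxs).not_ge hsk

theorem IsInternal.rel_of_le {δ : M.Num → M.Num} (hδ : M.IsInternal δ)
    {R : M.Num → M.Num → Prop} [Std.Refl R] [IsTrans M.Num R]
    (hR : M.BoundedDefinable fun v : Fin 2 → M.Num => R (v 0) (v 1))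
    (hstep : ∀ i, R (δ (i + 1)) (δ i)) {i j : M.Num} (hij : i ≤ j) : R (δ j) (δ i) := by
  obtain ⟨c, rfl⟩ := exists_add_of_le hij
  refine sigma01_induction (P := fun c => R (δ (i + c)) (δ i)) ?_ ?_ (fun c hc => ?_) c
  · exact (BoundedDefinable.comp₂ (P := fun a b => R (δ a) b) (hδ.boundedDefinable_comp hR)
      (.add (.const i) (.var 0)) (.const (δ i))).sigma01
  · rw [add_zero]
    exact refl_of R _
  · rw [← add_assoc]
    exact trans_of R (hstep _) hc

theorem IsInternal.injective_of_descending {δ : M.Num → M.Num} (hδ : M.IsInternal δ)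
    {R : M.Num → M.Num → Prop} [Std.Refl R] [IsTrans M.Num R]
    (hR : M.BoundedDefinable fun v : Fin 2 → M.Num => R (v 0) (v 1))
    (hstep : ∀ i, R (δ (i + 1)) (δ i)) (hstrict : ∀ i, ¬ R (δ i) (δ (i + 1))) :
    Function.Injective δ := by
  have hne {i j : M.Num} (hij : i < j) : δ i ≠ δ j := fun h =>
    hstrict i (h ▸ hδ.rel_of_le hR hstep (Order.add_one_le_iff.2 hij))
  exact fun i j h => le_antisymm (not_lt.1 fun hji => hne hji h.symm)
    (not_lt.1 fun hij => hne hij h)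

theorem exists_isInternal {G : M.Num → M.Num → Prop}
    (hG : M.BoundedDefinable fun v : Fin 2 → M.Num => G (v 0) (v 1)) (h : ∀ a, ∃! b, G a b) :
    ∃ f, M.IsInternal f ∧ ∀ a b, f a = b ↔ G a b := by
  choose f hf hunique using h
  have hgraph (a b : M.Num) : f a = b ↔ G a b := ⟨fun h => h ▸ hf a, fun h => (hunique a b h).symm⟩
  exact ⟨f, relationSet_mem_sets_iff.2 (hG.congr fun v => (hgraph _ _).symm), hgraph⟩

theorem IsFunction.exists_isInternal {F B : Set M.Num} (hF : F ∈ M.sets)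
    (hfun : M.IsFunction F Set.univ B) : ∃ δ, M.IsInternal δ ∧ ∀ a, M.pair a (δ a) ∈ F := by
  obtain ⟨δ, hδ, hgraph⟩ := Model.exists_isInternal (G := fun a b => M.pair a b ∈ F)
    (.mem (.pair (.var 0) (.var 1)) hF) fun a => hfun.2 a trivial
  exact ⟨δ, hδ, fun a => (hgraph a _).1 rfl⟩

end InternalFunctions

section TrueStages

variable {M : Model.{u}} [hM : Fact M.IsRCA0]

variable {f : M.Num → M.Num}

theorem IsInternal.boundedDefinable_stageLE (hf : M.IsInternal f) :
    M.BoundedDefinable fun v : Fin 2 → M.Num => StageLE f (v 0) (v 1) := by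
  have hbounded : M.BoundedDefinable fun v : Fin 2 → M.Num =>
      ∃ k, k < v 1 + 1 ∧ (v 0 < k ∧ f k < f (v 0)) :=
    .bex (.add (.var 1) (.const 1)) (.and (.lt (.var 1) (.var 0))
      (.comp₂ (P := fun a b => f a < f b) hf.boundedDefinable_lt (.var 0) (.var 1)))
  have hfalse : M.BoundedDefinable fun v : Fin 2 → M.Num => FalseAt f (v 0) (v 1) :=
    hbounded.congr fun v => by simp only [FalseAt, Order.lt_add_one_iff, and_left_comm]
  exact .or (.and (.lt (.var 0) (.var 1)) hfalse)
    (.and (.le (.var 1) (.var 0)) (hfalse.comp₂ (P := FalseAt f) (.var 1) (.var 0)).neg)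

theorem IsInternal.exists_trueStage (hf : M.IsInternal f) (s : M.Num) :
    ∃ k, s ≤ k ∧ TrueStage f k := by
  obtain ⟨_, ⟨k, hsk, rfl⟩, hleast⟩ := exists_least_of_sigma01 (P := fun a => ∃ k, s ≤ k ∧ f k = a)
    (.of_exists (P := fun a k => s ≤ k ∧ f k = a)
      (.and (.le (.const s) (.var 1)) (hf.boundedDefinable_apply_eq (.var 1) (.var 0))))
    ⟨f s, s, le_rfl, rfl⟩
  exact ⟨k, hsk, fun l hkl => not_lt.1 fun hlt => hleast _ hlt ⟨l, hsk.trans hkl.le, rfl⟩⟩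

/-- A number is in the range of `f` if and only if it is enumerated by any given true stage with a
larger value. -/
theorem IsInternal.range_mem_of_trueStages (hf : M.IsInternal f) (hinj : Function.Injective f)
    {U : M.Num → Prop} (hU : M.Sigma01Definable fun v : Fin 1 → M.Num => U (v 0))
    (htrue : ∀ s, U s → TrueStage f s) (hunbounded : ∀ b, ∃ s, b ≤ s ∧ U s) :
    Set.range f ∈ M.sets := by
  have hgt : M.BoundedDefinable fun v : Fin 2 → M.Num => v 1 < f (v 0) :=
    hf.boundedDefinable_comp (R := fun b a => a < b) (.lt (.var 1) (.var 0))
  have hcompl : M.Sigma01Definable fun v : Fin 1 → M.Num =>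
      ∃ s, U s ∧ (v 0 < f s ∧ ∀ x, x < s + 1 → ¬ f x = v 0) :=
    .ex (.and (hU.comp₁ (.var 0)) (BoundedDefinable.and hgt (.ball (.add (.var 0) (.const 1))
      (.neg (hf.boundedDefinable_apply_eq (.var 0) (.var 2))))).sigma01)
  refine delta01_comprehension (P := (· ∈ Set.range f)) hf.sigma01Definable_mem_range
    (hcompl.congr fun v => ⟨?_, fun hv => ?_⟩)
  · rintro ⟨s, hs, hlt, hne⟩ ⟨x, hx⟩
    have hsx : s < x := not_le.1 fun hxs => hne x (Order.lt_add_one_iff.2 hxs) hx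
    exact (htrue s hs x hsx).not_gt (hx ▸ hlt)
  · obtain ⟨b, hb⟩ := hf.exists_forall_lt hinj (v 0)
    obtain ⟨s, hbs, hs⟩ := hunbounded b
    exact ⟨s, hs, hb s hbs, fun x _ hx => hv ⟨x, hx⟩⟩

/-- A descending sequence of stages consists of true stages: a false stage lies above only
boundedly many others. -/
theorem IsInternal.range_mem_of_descending (hf : M.IsInternal f) (hinj : Function.Injective f)
    {δ : M.Num → M.Num} (hδ : M.IsInternal δ) (hstep : ∀ i, StageLE f (δ (i + 1)) (δ i))
    (hstrict : ∀ i, ¬ StageLE f (δ i) (δ (i + 1))) : Set.range f ∈ M.sets := by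
  have hle := hf.boundedDefinable_stageLE
  have htendsto := hδ.exists_forall_lt (hδ.injective_of_descending hle hstep hstrict)
  refine hf.range_mem_of_trueStages hinj hδ.sigma01Definable_mem_range ?_ fun b => ?_
  · rintro _ ⟨i, rfl⟩
    by_contra hfalse
    obtain ⟨k, hk⟩ := exists_falseAt_of_not_trueStage hfalse
    obtain ⟨s, hs⟩ := htendsto k
    exact (hs _ (le_max_right i s)).not_gt
      (hk.lt_of_stageLE (hδ.rel_of_le hle hstep (le_max_left i s)))
  · obtain ⟨s, hs⟩ := htendsto b
    exact ⟨δ s, (hs s le_rfl).le, s, rfl⟩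

theorem IsInternal.isWellOrder_stageLE (hf : M.IsInternal f) (hinj : Function.Injective f)
    (hrange : Set.range f ∉ M.sets) : M.IsWellOrder Set.univ (M.relationSet (StageLE f)) where
  carrier_mem := bounded_comprehension (.const True)
  rel_mem := relationSet_mem_sets_iff.2 hf.boundedDefinable_stageLE
  rel_subset := fun _ ⟨a, b, h, _⟩ => ⟨a, trivial, b, trivial, h⟩
  refl a _ := pair_mem_relationSet.2 (refl_of (StageLE f) a)
  trans a _ b _ c _ hab hbc := pair_mem_relationSet.2
    (trans_of (StageLE f) (pair_mem_relationSet.1 hab) (pair_mem_relationSet.1 hbc))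
  antisymm a _ b _ hab hba :=
    StageLE.antisymm (pair_mem_relationSet.1 hab) (pair_mem_relationSet.1 hba)
  total a _ b _ := (StageLE.total a b).imp pair_mem_relationSet.2 pair_mem_relationSet.2
  no_descending := by
    rintro ⟨F, hF, hfun, hdesc⟩
    obtain ⟨δ, hδ, hδF⟩ := hfun.exists_isInternal hF
    have hdesc (i) := hdesc i (δ i) (δ (i + 1)) (hδF i) (hδF (i + 1))
    exact hrange (hf.range_mem_of_descending hinj hδ
      (fun i => pair_mem_relationSet.1 (hdesc i).1)
      fun i h => (hdesc i).2 (pair_mem_relationSet.2 h))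

theorem IsInternal.exists_descent_of_not_trueStage (hf : M.IsInternal f) {a : M.Num}
    (ha : ¬ TrueStage f a) : ∃ e, a ≤ e ∧ f (e + 1) < f e := by
  obtain ⟨k, ⟨hak, hlt⟩, hleast⟩ := exists_least_of_sigma01 (P := fun k => a < k ∧ f k < f a)
    (BoundedDefinable.and (.lt (.const a) (.var 0))
      (.comp₂ (P := fun a b => f a < f b) hf.boundedDefinable_lt (.var 0) (.const a))).sigma01
    (by simpa only [TrueStage, not_forall, not_le, exists_prop] using ha)
  obtain rfl | ⟨e, rfl⟩ := eq_zero_or_eq_add_one k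
  · exact absurd hak not_lt_zero
  refine ⟨e, Order.lt_add_one_iff.1 hak, ?_⟩
  rcases (Order.lt_add_one_iff.1 hak).eq_or_lt with rfl | hae
  · exact hlt
  · exact hlt.trans_le (not_lt.1 fun h => hleast e (lt_add_one e) ⟨hae, h⟩)

theorem IsInternal.exists_descent (hf : M.IsInternal f) (hinj : Function.Injective f)
    (hrange : Set.range f ∉ M.sets) (s : M.Num) : ∃ e, s ≤ e ∧ f (e + 1) < f e := by
  by_contra! hno
  refine hrange (hf.range_mem_of_trueStages hinj (U := (s ≤ ·))
    (BoundedDefinable.le (.const s) (.var 0)).sigma01 (fun k hsk => ?_)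
    fun b => ⟨max b s, le_max_left b s, le_max_right b s⟩)
  by_contra hk
  obtain ⟨e, hke, he⟩ := hf.exists_descent_of_not_trueStage hk
  exact (hno e (hsk.trans hke)).not_gt he

theorem trueStage_iff (hdescent : ∀ s, ∃ e, s ≤ e ∧ f (e + 1) < f e) {s : M.Num} :
    TrueStage f s ↔ ∀ e, f (e + 1) < f e → ¬ StageLE f s e := by
  refine ⟨fun hs e he hle => ?_, fun h => ?_⟩
  · rcases hle with ⟨-, hse⟩ | ⟨hes, hse⟩
    · exact hs.not_falseAt hse
    rcases hes.eq_or_lt with rfl | hlt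
    · exact (hs _ (lt_add_one e)).not_gt he
    · exact hse ⟨e + 1, lt_add_one e, Order.add_one_le_iff.2 hlt, he⟩
  · by_contra hs
    obtain ⟨k, hk⟩ := exists_falseAt_of_not_trueStage hs
    obtain ⟨e, hke, he⟩ := hdescent k
    exact h e he (.inl ⟨(hk.mono hke).lt, hk.mono hke⟩)

theorem PrincipalFlatClosed.sigma01Definable {Q R E : Set M.Num} (hQ : Q ∈ M.sets)
    (hR : R ∈ M.sets) (hE : M.PrincipalFlatClosed Q R E) :
    M.Sigma01Definable fun v : Fin 1 → M.Num => v 0 ∈ Q ∧ ∀ e ∈ E, M.pair (v 0) e ∉ R := by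
  obtain ⟨h, hh, -, hclosed⟩ := hE
  have hopen : M.Sigma01Definable fun v : Fin 1 → M.Num => v 0 ∈ Q ∧ ∃ n c i,
      M.pair n c ∈ h ∧ M.FinMem i c ∧ ∀ q, q < i → M.FinMem q i → M.pair q (v 0) ∈ R :=
    .and (BoundedDefinable.mem (.var 0) hQ).sigma01 (.ex (.ex (.ex (BoundedDefinable.and
      (.mem (.pair (.var 2) (.var 1)) hh) (.and (boundedDefinable_finMem.comp₂ (.var 0) (.var 1))
        (.ball (.var 0) (.imp (boundedDefinable_finMem.comp₂ (.var 0) (.var 1))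
          (.mem (.pair (.var 0) (.var 4)) hR))))).sigma01)))
  refine hopen.congr fun v => and_congr_right fun hv => ?_
  have hsingleton : {v 0} ∈ M.sets :=
    bounded_comprehension (P := (· = v 0)) (.eq (.var 0) (.const (v 0)))
  have hv := not_congr (hclosed {v 0} hsingleton (Set.singleton_subset_iff.2 hv))
  simp only [FlatLE, FlatInClosed, FlatInBasic, Set.mem_singleton_iff, forall_eq, exists_eq_left,
    not_exists, not_and, not_forall, not_not, exists_prop] at hv
  rw [hv]
  refine exists_congr fun n => exists_congr fun c => ?_
  simp only [exists_and_left]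
  refine and_congr_right fun _ => exists_congr fun i => and_congr_right fun _ => ?_
  exact ⟨fun H q hq => H q hq.lt hq, fun H q _ => H q⟩

theorem FlatClosedForWellOrders.range_mem (h : M.FlatClosedForWellOrders) (hf : M.IsInternal f)
    (hinj : Function.Injective f) : Set.range f ∈ M.sets := by
  by_contra hrange
  have hW := hf.isWellOrder_stageLE hinj hrange
  have hE : {e | f (e + 1) < f e} ∈ M.sets := bounded_comprehension
    (.comp₂ (P := fun a b => f a < f b) hf.boundedDefinable_lt (.add (.var 0) (.const 1)) (.var 0))
  have htrue := (h _ _ _ hW hE (Set.subset_univ _)).sigma01Definable hW.carrier_mem hW.rel_mem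
  refine hrange (hf.range_mem_of_trueStages hinj (U := TrueStage f)
    (htrue.congr fun v => ?_) (fun _ hs => hs) hf.exists_trueStage)
  simp only [Set.mem_univ, true_and, Set.mem_ofPred_eq, pair_mem_relationSet,
    trueStage_iff (hf.exists_descent hinj hrange)]

end TrueStages

section Enumeration

variable {M : Model.{u}} [hM : Fact M.IsRCA0]

theorem Sigma01Definable.exists_functional_matrix {P : M.Num → Prop}
    (hP : M.Sigma01Definable fun v : Fin 1 → M.Num => P (v 0)) :
    ∃ Q : M.Num → M.Num → Prop, (M.BoundedDefinable fun v : Fin 2 → M.Num => Q (v 0) (v 1)) ∧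
      (∀ a x y, Q a x → Q a y → x = y) ∧ ∀ a, P a ↔ ∃ x, Q a x := by
  obtain ⟨Q, hQ, hPQ⟩ := hP.exists_matrix
  refine ⟨fun a x => Q a x ∧ ∀ y, y < x → ¬ Q a y,
    .and hQ (.ball (.var 1) (.neg (hQ.comp₂ (.var 1) (.var 0)))), fun a x y hx hy => ?_,
    fun a => ?_⟩
  · exact le_antisymm (not_lt.1 fun h => hx.2 y h hy.1) (not_lt.1 fun h => hy.2 x h hx.1)
  · rw [hPQ]
    exact ⟨exists_least_of_sigma01 (P := Q a) (hQ.comp₂ (.const a) (.var 0)).sigma01,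
      fun ⟨x, hx, _⟩ => ⟨x, hx⟩⟩

theorem exists_isInternal_of_witnesses {Q : M.Num → M.Num → Prop}
    (hQ : M.BoundedDefinable fun v : Fin 2 → M.Num => Q (v 0) (v 1)) :
    ∃ f, M.IsInternal f ∧ ∀ k, (∃ n x, k = M.pair n x ∧ Q n x ∧ f k = M.pair n 0) ∨
      (¬ ∃ n x, k = M.pair n x ∧ Q n x) ∧ f k = M.pair k 1 := by
  let IsWitness (k : M.Num) : Prop := ∃ n x, k = M.pair n x ∧ Q n x
  let Graph (k b : M.Num) : Prop :=
    (∃ n x, k = M.pair n x ∧ Q n x ∧ b = M.pair n 0) ∨ ¬ IsWitness k ∧ b = M.pair k 1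
  have hgraph : M.BoundedDefinable fun v : Fin 2 → M.Num => Graph (v 0) (v 1) :=
    .or (.exists_pair (P := fun v n x => Q n x ∧ v 1 = M.pair n 0) (.var 0)
      (.and (hQ.comp₂ (.var 1) (.var 0)) (.eq (.var 3) (.pair (.var 1) (.const 0)))))
      (.and (.neg (.exists_pair (P := fun _ n x => Q n x) (.var 0)
        (hQ.comp₂ (.var 1) (.var 0)))) (.eq (.var 1) (.pair (.var 0) (.const 1))))
  have hfunctional (k) : ∃! b, Graph k b := by
    by_cases hk : IsWitness k
    · obtain ⟨n, x, rfl, hx⟩ := hk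
      refine ⟨M.pair n 0, .inl ⟨n, x, rfl, hx, rfl⟩, ?_⟩
      rintro _ (⟨n', x', h, -, rfl⟩ | ⟨hk, -⟩)
      · rw [(pair_inj.1 h).1]
      · exact absurd ⟨n, x, rfl, hx⟩ hk
    · refine ⟨M.pair k 1, .inr ⟨hk, rfl⟩, ?_⟩
      rintro _ (⟨n, x, h, hx, -⟩ | ⟨-, rfl⟩)
      · exact absurd ⟨n, x, h, hx⟩ hk
      · rfl
  obtain ⟨f, hf, hfgraph⟩ := exists_isInternal hgraph hfunctional
  exact ⟨f, hf, fun k => (hfgraph k _).1 rfl⟩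

theorem exists_injective_enumeration {Q : M.Num → M.Num → Prop}
    (hQ : M.BoundedDefinable fun v : Fin 2 → M.Num => Q (v 0) (v 1))
    (hunique : ∀ n x y, Q n x → Q n y → x = y) :
    ∃ f, M.IsInternal f ∧ Function.Injective f ∧
      ∀ n, M.pair n 0 ∈ Set.range f ↔ ∃ x, Q n x := by
  obtain ⟨f, hf, hvalue⟩ := exists_isInternal_of_witnesses hQ
  refine ⟨f, hf, fun k l hkl => ?_, fun n => ⟨?_, fun ⟨x, hx⟩ => ⟨M.pair n x, ?_⟩⟩⟩
  · rcases hvalue k with ⟨n, x, rfl, hx, hk⟩ | ⟨-, hk⟩ <;>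
      rcases hvalue l with ⟨n', x', rfl, hx', hl⟩ | ⟨-, hl⟩ <;>
      obtain ⟨h₁, h₂⟩ := pair_inj.1 (hk.symm.trans (hkl.trans hl))
    · subst h₁
      rw [hunique n x x' hx hx']
    · exact absurd h₂ zero_ne_one
    · exact absurd h₂ one_ne_zero
    · exact h₁
  · rintro ⟨k, hk⟩
    rcases hvalue k with ⟨n', x, -, hx, h⟩ | ⟨-, h⟩ <;>
      obtain ⟨h₁, h₂⟩ := pair_inj.1 (hk.symm.trans h)
    · exact h₁ ▸ ⟨x, hx⟩
    · exact absurd h₂ zero_ne_one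
  · rcases hvalue (M.pair n x) with ⟨n', x', h, -, hf⟩ | ⟨hno, -⟩
    · rw [hf, (pair_inj.1 h).1]
    · exact absurd ⟨n, x, rfl, hx⟩ hno

theorem FlatClosedForWellOrders.sigma01Comprehension (h : M.FlatClosedForWellOrders) :
    M.Sigma01Comprehension := by
  intro P hP
  obtain ⟨Q, hQ, hunique, hPQ⟩ := hP.exists_functional_matrix
  obtain ⟨f, hf, hinj, hrange⟩ := exists_injective_enumeration hQ hunique
  have hset := bounded_comprehension (P := fun n => M.pair n 0 ∈ Set.range f)
    (.mem (.pair (.var 0) (.const 0)) (h.range_mem hf hinj))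
  simpa only [hrange, ← hPQ] using hset

end Enumeration

end Model

end SecondOrderArith

/-- Over `RCA₀` the three statements are equivalent: they have the same truth value in every
model of `RCA₀`. -/
theorem proposition3p10 (M : SecondOrderArith.Model.{u}) (hM : M.IsRCA0) :
    List.TFAE [M.IsACA0, M.FlatClosedForQuasiOrders, M.FlatClosedForWellOrders] := by
  have : Fact M.IsRCA0 := ⟨hM⟩
  tfae_have 1 → 2 := fun h => h.sigma01Comprehension.flatClosedForQuasiOrders
  tfae_have 2 → 3 := fun h W R E hW => h W R E hW.toIsQuasiOrder
  tfae_have 3 → 1 := fun h => h.sigma01Comprehension.isACA0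
  tfae_finish
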